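/- All graphs are finite and simple. For a graph $G$, an $E$-process on $G$ started at a vertex $u$ is a random sequence $X(0)=u, X(1), X(2),\dots$ of vertices evolving as follows, where an edge is called visited once the process has made a transition along it, in either direction. If there are unvisited edges incident with $X(t)$, one of them is picked according to some rule $\mathcal A$ and the process moves along it; the rule is arbitrary, may depend on the whole history and on additional randomness, and so may be an on-line adversary. If all edges incident with $X(t)$ are visited, then, conditionally on the history, $X(t+1)$ is a uniformly random neighbour of $X(t)$. The vertex cover time $C_G(E\text{-process})$ is the maximum over start vertices $u$ of the expected first time at which every vertex has been visited. A graph $G$ is $\ell$-good ($\ell>0$ real) if for every vertex $v$, every subgraph of $G$ that contains $v$ and all edges of $G$ incident with $v$, and in which all degrees are even, has at least $\ell$ vertices. Let $\lambda_{\max}$ be the largest absolute value of an eigenvalue other than $1$ of the transition matrix of the simple random walk on $G$, or of the lazy walk, which stays put with probability $1/2$ and otherwise makes a step of the simple random walk. **Theorem.** For every $\Delta$ there is a constant $C=C(\Delta)$ such that the following holds. Let $G$ be a connected $n$-vertex graph, all of whose degrees are even and at most $\Delta$, and suppose that $G$ is $\ell$-good. Then every $E$-process on $G$, whatever the rule $\mathcal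 A$, satisfies $$C_G(E\text{-process}) \le C\left(n+\frac{n\log n}{\ell(1-\lambda_{\max})}\right),$$ for both versions of $\lambda_{\max}$ (the bound is read as $\infty$ if $n\ge2$ and $\lambda_{\max}=1$, which occurs only for the simple walk on a bipartite graph). In particular, for graphs as above which moreover satisfy $1-\lambda_{\max}\ge\varepsilon$ for a fixed $\varepsilon>0$, $C_G(E\text{-process})=O(n+n\log n/\ell)$ with a constant depending only on $\Delta$ and $\varepsilon$; and if moreover $\ell\ge c\log n$ for a fixed $c>0$, then $n-1\le C_G(E\text{-process})\le C'n$ with $C'$ depending only on $\Delta,\varepsilon,c$, that is, $C_G(E\text{-process})=\Theta(n)$. -/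

import Mathlib

open MeasureTheory
open scoped ENNReal NNReal

universe u v

section Graphs

variable {V : Type u}

/-- `H` is an even degree subgraph that contains the vertex `v` and all edges of `G` incident
with `v`. -/
def IsEvenSubgraphAround (G : SimpleGraph V) (v : V) (H : G.Subgraph) : Prop :=
  v ∈ H.verts ∧ (∀ w, G.Adj v w → H.Adj v w) ∧ ∀ x ∈ H.verts, Even (H.neighborSet x).ncard

/-- The vertex `v` is `ℓ`-good: every even degree subgraph containing all edges incident with `v`
has at least `ℓ` vertices. -/
def IsGoodVertex (G : SimpleGraph V) (ℓ : ℝ) (v : V) : Prop :=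
  ∀ H : G.Subgraph, IsEvenSubgraphAround G v H → ℓ ≤ (H.verts.ncard : ℝ)

/-- The graphs considered: connected, all degrees even, all degrees at most `Δ`, every vertex
`ℓ`-good. -/
structure IsGoodEvenGraph [Fintype V] (G : SimpleGraph V) [DecidableRel G.Adj]
    (Δ : ℕ) (ℓ : ℝ) : Prop where
  connected : G.Connected
  even_degree : ∀ v, Even (G.degree v)
  degree_le : ∀ v, G.degree v ≤ Δ
  good : ∀ v, IsGoodVertex G ℓ v

/-- The transition matrix of the simple random walk. -/
noncomputable def walkMatrix [Fintype V] (G : SimpleGraph V) [DecidableRel G.Adj] :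
    Matrix V V ℝ :=
  Matrix.of fun x y => if G.Adj x y then 1 / (G.degree x : ℝ) else 0

/-- The transition matrix of the lazy random walk, which stays put with probability `1/2`. -/
noncomputable def lazyWalkMatrix [Fintype V] [DecidableEq V] (G : SimpleGraph V)
    [DecidableRel G.Adj] : Matrix V V ℝ :=
  (1 / 2 : ℝ) • (1 + walkMatrix G)

/-- The largest absolute value of an eigenvalue other than `1`. For the walk matrices of a
connected graph on at least two vertices, `1` is a simple eigenvalue and all eigenvalues are real,
so that this is `max(|λ₂|, |λₙ|)`. -/
noncomputable def lambdaMax [Fintype V] [DecidableEq V] (P : Matrix V V ℝ) : ℝ :=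
  sSup {r : ℝ | ∃ a : ℝ, Module.End.HasEigenvalue (Matrix.toLin' P) a ∧ a ≠ 1 ∧ r = |a|}

end Graphs

section Walks

variable {V : Type u} {Ω : Type v}

/-- The neighbours of `x t` that are joined to `x t` by an edge which the trajectory `x` has not
traversed, in either direction, during its first `t` transitions. -/
def unvisitedNeighbors (G : SimpleGraph V) (x : ℕ → V) (t : ℕ) : Set V :=
  {w | G.Adj (x t) w ∧ ¬ ∃ i < t, s(x i, x (i + 1)) = s(x t, w)}

/-- `X` is an `E`-process on `G` started at `u`: whenever there are unvisited edges at the current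
vertex, the next transition is along one of them (nothing is assumed on how it is chosen: it may
depend on the whole past and on additional randomness); whenever there are none, then, conditionally
on the trajectory so far, the next vertex is a uniformly random neighbour. -/
structure IsEProcess [Fintype V] [MeasurableSpace Ω] (G : SimpleGraph V) [DecidableRel G.Adj]
    (μ : Measure Ω) (X : ℕ → Ω → V) (u : V) : Prop where
  measurable : ∀ t v, MeasurableSet {ω | X t ω = v}
  start : ∀ᵐ ω ∂μ, X 0 ω = u
  unvisited_step : ∀ t, ∀ᵐ ω ∂μ,
    (unvisitedNeighbors G (fun i => X i ω) t).Nonempty →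
      X (t + 1) ω ∈ unvisitedNeighbors G (fun i => X i ω) t
  random_step : ∀ (t : ℕ) (x : ℕ → V), unvisitedNeighbors G x t = ∅ → ∀ w, G.Adj (x t) w →
    μ {ω | (∀ i ≤ t, X i ω = x i) ∧ X (t + 1) ω = w} =
      μ {ω | ∀ i ≤ t, X i ω = x i} / (G.degree (x t) : ℝ≥0∞)

/-- The first time at which the trajectory `x` has visited every vertex (`⊤` if there is none). -/
noncomputable def coverStep (x : ℕ → V) : ℝ≥0∞ :=
  ⨅ (t : ℕ) (_ : ∀ v, ∃ i ≤ t, x i = v), (t : ℝ≥0∞)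

/-- The vertex cover time of a process given by its version `X v`, under the law `μ v`, for each
start vertex `v`: the maximum over `v` of the expected time to visit every vertex. -/
noncomputable def vertexCoverTime [MeasurableSpace Ω] (μ : V → Measure Ω)
    (X : V → ℕ → Ω → V) : ℝ≥0∞ :=
  ⨆ v, ∫⁻ ω, coverStep (fun t => X v t ω) ∂(μ v)

end Walks

/-!
Call a transition of the process blue if it uses an unvisited edge and red otherwise. There are at
most `|E|` blue transitions. As all degrees are even, a blue phase can end only where it started
(`IsValid.even_iff`), so the red transitions alone form a simple random walk. When no blue phase is
under way, the unvisited edges form an even graph, and no red transition has started in a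
nontrivial component of it; the component of an unvisited vertex has at least `ℓ` vertices. It
remains to bound the time until the random walk has hit all possible such components.

A union bound over all connected sets of `ℓ` vertices has about `exp(C ℓ)` terms, which is too many
if `ℓ` is much larger than `log n`. Instead, each component is explored from its vertex `v` until
either `ℓ` vertices or `J = C log n` branch vertices (of degree at least four) are found. Vertices of
degree two leave no choice in this exploration, so at most `2 ^ (Δ J)`, polynomially many, explored
sets ("certificates") arise for each `v` (`exists_certificates`).

With `γ = 1 - λ_max`, the walk hits a given certificate at rate at least of order `γ ℓ / n`
(`IsGoodEvenGraph.dirichlet_ge`, `survival_le`). By the Poincaré inequality this reduces to a bound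
`γ ℓ / 4` for the capacity of the certificate with respect to killing at rate `γ`
(`IsGoodEvenGraph.capacity_ge`). It is clear for certificates with `ℓ` vertices. For those with many
branch vertices it follows from the coarea formula and two facts about good graphs:

* a set of fewer than `ℓ` vertices that contains a connected set with `J` branch vertices has at
  least `c J` boundary vertices (`card_branchVertices_le`): some spanning tree has that many leaves,
  and a leaf all of whose neighbours lie in the set would be the centre of an even subgraph of fewer
  than `ℓ` vertices;
* `ℓ √γ ≤ C log n` (`IsGoodEvenGraph.mul_sqrt_gap_le`): `ℓ` is at most of the order of the diameter,
  and the volume of balls doubles with each increase of the radius by `O(1 / √γ)`.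

So after `O(n log n / (γ ℓ))` red transitions the union bound over all certificates is small.
-/

/-! ### Even subgraphs from walks -/

section TJoin

variable {V : Type*} [Fintype V] [DecidableEq V] {G : SimpleGraph V}

/-- Modulo two, the number of edges of a walk at a vertex is odd exactly at its two ends. -/
lemma sum_count_edges_parity {o w : V} (p : G.Walk o w) (a : V) :
    (∑ b, (p.edges.count s(a, b) : ZMod 2)) =
      (if a = o then 1 else 0) + (if a = w then 1 else 0) := by
  induction p with
  | nil => simp [CharTwo.add_self_eq_zero]
  | @cons x y z h p ih =>
    have hne : x ≠ y := h.ne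
    have key : (∑ b, (if s(x, y) = s(a, b) then (1 : ZMod 2) else 0)) =
        (if a = x then 1 else 0) + (if a = y then 1 else 0) := by
      by_cases hax : a = x
      · subst hax
        have : ∀ b, (s(a, y) = s(a, b)) ↔ y = b := by
          intro b; rw [Sym2.eq_iff]; constructor
          · rintro (h | h)
            · exact h.2
            · exact absurd h.2.symm hne
          · intro h; exact Or.inl ⟨rfl, h⟩
        simp [this, hne]
      · by_cases hay : a = y
        · subst hay
          have : ∀ b, (s(x, a) = s(a, b)) ↔ x = b := by
            intro b; rw [Sym2.eq_iff]; constructor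
            · rintro (h | h)
              · exact absurd h.1.symm hax
              · exact h.1
            · intro h; exact Or.inr ⟨h, rfl⟩
          simp [this, hax]
        · have : ∀ b, ¬ (s(x, y) = s(a, b)) := by
            intro b; rw [Sym2.eq_iff]
            rintro (h | h)
            · exact hax h.1.symm
            · exact hay h.2.symm
          simp [this, hax, hay]
    have h2 : ∀ b, (((SimpleGraph.Walk.cons h p).edges.count s(a, b) : ℕ) : ZMod 2) =
        (p.edges.count s(a, b) : ZMod 2) + (if s(x, y) = s(a, b) then (1 : ZMod 2) else 0) := by
      intro b
      rw [SimpleGraph.Walk.edges_cons, List.count_cons]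
      simp
    rw [Finset.sum_congr rfl (fun b _ => h2 b), Finset.sum_add_distrib, ih, key]
    have := CharTwo.add_self_eq_zero (R := ZMod 2) (if a = y then (1 : ZMod 2) else 0)
    linear_combination this

/-- If the neighbours of a vertex `x` of even degree can be joined to a vertex `o` by walks avoiding
`x`, then the edges used an odd number of times by the walks, together with the star of `x`, form an
even subgraph around `x`. -/
lemma exists_evenSubgraphAround [DecidableRel G.Adj] {x o : V} (hx : Even (G.degree x))
    (p : ∀ w, G.Walk o w) (hp : ∀ w, G.Adj x w → x ∉ (p w).support) :
    ∃ H : G.Subgraph, IsEvenSubgraphAround G x H ∧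
      H.verts = {x} ∪ ⋃ w ∈ G.neighborSet x, {y | y ∈ (p w).support} := by
  -- the multiplicity, modulo two, of an edge in the union of the walks and the star of `x`
  let c : Sym2 V → ZMod 2 := fun e =>
    (∑ w ∈ G.neighborFinset x, ((p w).edges.count e : ZMod 2)) + if x ∈ e then 1 else 0
  have hc0 : ∀ a b, c s(a, b) = 1 →
      a ∈ ({x} ∪ ⋃ w ∈ G.neighborSet x, {y | y ∈ (p w).support} : Set V) ∨ G.Adj x a ∨ x = b := by
    intro a b hab
    by_contra hcon
    push Not at hcon
    obtain ⟨h1, h2, h3⟩ := hcon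
    have hxa : x ≠ a := by rintro rfl; simp at h1
    have hz : c s(a, b) = 0 := by
      simp only [c]
      rw [Finset.sum_eq_zero]
      · simp [hxa, h3]
      · intro w hw
        rw [List.count_eq_zero.2]
        · simp
        · intro hmem
          apply h1
          right
          simp only [Set.mem_iUnion]
          exact ⟨w, by simpa using hw, (p w).fst_mem_support_of_mem_edges hmem⟩
    rw [hz] at hab
    exact absurd hab (by decide)
  let H : G.Subgraph :=
    { verts := {x} ∪ ⋃ w ∈ G.neighborSet x, {y | y ∈ (p w).support}
      Adj := fun a b => G.Adj a b ∧ c s(a, b) = 1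
      adj_sub := fun h => h.1
      edge_vert := by
        rintro a b ⟨hab, hcab⟩
        rcases hc0 a b hcab with h | h | h
        · exact h
        · right
          simp only [Set.mem_iUnion]
          exact ⟨a, h, (p a).end_mem_support⟩
        · right
          simp only [Set.mem_iUnion]
          subst h
          exact ⟨a, hab.symm, (p a).end_mem_support⟩
      symm := ⟨by
        rintro a b ⟨hab, hcab⟩
        exact ⟨hab.symm, by rwa [Sym2.eq_swap]⟩⟩ }
  refine ⟨H, ⟨by simp [H], ?_, ?_⟩, rfl⟩
  · intro w hw
    refine ⟨hw, ?_⟩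
    simp only [c]
    rw [Finset.sum_eq_zero]
    · simp
    · intro w' hw'
      rw [List.count_eq_zero.2]
      · simp
      · intro hmem
        exact hp w' (by simpa using hw') ((p w').fst_mem_support_of_mem_edges hmem)
  · intro a _
    have hset : H.neighborSet a =
        ((G.neighborFinset a).filter fun b => c s(a, b) = 1 : Finset V) := by
      ext b; simp [H]
    rw [hset, Set.ncard_coe_finset]
    have hz : ((((G.neighborFinset a).filter fun b => c s(a, b) = 1).card : ℕ) : ZMod 2) =
        ∑ b ∈ G.neighborFinset a, c s(a, b) := by
      rw [Finset.card_filter]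
      push_cast
      refine Finset.sum_congr rfl fun b _ => ?_
      generalize c s(a, b) = t
      revert t; decide
    rw [← ZMod.natCast_eq_zero_iff_even, hz]
    simp only [c]
    rw [Finset.sum_add_distrib, Finset.sum_comm]
    have h1 : ∀ w ∈ G.neighborFinset x,
        ∑ b ∈ G.neighborFinset a, ((p w).edges.count s(a, b) : ZMod 2) =
        (if a = o then 1 else 0) + (if a = w then 1 else 0) := by
      intro w _
      rw [← sum_count_edges_parity (p w) a]
      apply Finset.sum_subset (Finset.subset_univ _)
      intro b _ hb
      rw [List.count_eq_zero.2]
      · simp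
      · intro hmem
        exact hb (by simpa using (p w).adj_of_mem_edges hmem)
    have hev : (G.degree x : ZMod 2) = 0 := (ZMod.natCast_eq_zero_iff_even).2 hx
    have h2 : ∑ b ∈ G.neighborFinset a, (if x ∈ s(a, b) then (1 : ZMod 2) else 0) =
        if G.Adj x a then 1 else 0 := by
      by_cases hxa : x = a
      · subst hxa
        simp [hev]
      · simp [hxa, G.adj_comm]
    rw [Finset.sum_congr rfl h1, h2, Finset.sum_add_distrib]
    simp [hev, CharTwo.add_self_eq_zero]

end TJoin

/-! ### Isoperimetry: small sets have as many boundary vertices as branch vertices -/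

section Isoperimetry

variable {V : Type*} [Fintype V] [DecidableEq V] {G : SimpleGraph V} [DecidableRel G.Adj]

lemma IsGoodVertex.le_ncard_of_walks {ℓ : ℝ} {x : V} (hG : G.Connected)
    (hx : Even (G.degree x)) (hgood : IsGoodVertex G ℓ x) {Q : Set V} (hxQ : x ∈ Q) (o : V)
    (h : ∀ w, G.Adj x w → ∃ p : G.Walk o w, x ∉ p.support ∧ ∀ y ∈ p.support, y ∈ Q) :
    ℓ ≤ (Q.ncard : ℝ) := by
  have h' : ∀ w, ∃ p : G.Walk o w, G.Adj x w → x ∉ p.support ∧ ∀ y ∈ p.support, y ∈ Q := by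
    intro w
    by_cases hw : G.Adj x w
    · obtain ⟨p, hp⟩ := h w hw
      exact ⟨p, fun _ => hp⟩
    · obtain ⟨p⟩ := hG.preconnected o w
      exact ⟨p, fun hw' => absurd hw' hw⟩
  choose p hp using h'
  obtain ⟨H, hH, hv⟩ := exists_evenSubgraphAround hx p fun w hw => (hp w hw).1
  refine (hgood H hH).trans ?_
  have : H.verts ⊆ Q := by
    rw [hv]
    refine Set.union_subset (by simpa using hxQ) ?_
    simp only [Set.iUnion_subset_iff]
    exact fun w hw y hy => (hp w hw).2 y hy
  exact_mod_cast Set.ncard_le_ncard this (Set.toFinite _)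

/-- A leaf of a spanning tree of a set with fewer than `ℓ` vertices has a neighbour outside of the
set, because removing the leaf leaves the rest connected. -/
lemma IsGoodVertex.le_ncard_of_leaf {ℓ : ℝ} {R : Set V} (hG : G.Connected)
    (T : SimpleGraph R) [T.LocallyFinite] (hT : T.Connected) (hTG : T ≤ G.induce R) (y : R)
    (hy : T.degree y = 1) (hyR : ∀ w, G.Adj y w → w ∈ R)
    (heven : Even (G.degree y)) (hgood : IsGoodVertex G ℓ y) :
    ℓ ≤ (R.ncard : ℝ) := by
  have hc := hT.induce_compl_singleton_of_degree_eq_one hy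
  obtain ⟨o⟩ := hc.nonempty
  refine hgood.le_ncard_of_walks hG heven y.2 (o : R) fun w hw => ?_
  have hwy : (⟨w, hyR w hw⟩ : R) ∈ ({y}ᶜ : Set R) := by
    intro hcon
    have : w = y := congrArg Subtype.val hcon
    exact hw.ne this.symm
  obtain ⟨q⟩ := hc.preconnected o ⟨⟨w, hyR w hw⟩, hwy⟩
  let f : (T.induce ({y}ᶜ : Set R)) →g G :=
    { toFun := fun z => (z : R)
      map_rel' := fun {a b} hab => hTG hab }
  refine ⟨q.map f, ?_, ?_⟩
  · rw [SimpleGraph.Walk.support_map]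
    intro hmem
    obtain ⟨z, _, hz⟩ := List.mem_map.1 hmem
    exact z.2 (Subtype.ext hz)
  · rw [SimpleGraph.Walk.support_map]
    intro a ha
    obtain ⟨z, _, rfl⟩ := List.mem_map.1 ha
    exact z.1.2

/-- The union of the stars of `G` centred at the vertices of `I`. -/
def starGraph {W : Type*} (G : SimpleGraph W) (I : Set W) : SimpleGraph W where
  Adj a b := G.Adj a b ∧ (a ∈ I ∨ b ∈ I)
  symm := ⟨fun _ _ h => ⟨h.1.symm, h.2.symm⟩⟩
  loopless := ⟨fun a h => G.loopless.irrefl a h.1⟩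

/-- Stars with pairwise disjoint closed neighbourhoods form a forest: an edge at a centre is the
only edge at its other end, hence a bridge. -/
lemma starGraph_isAcyclic {W : Type*} (G : SimpleGraph W) (I : Set W)
    (hI : ∀ a ∈ I, ∀ b ∈ I, a ≠ b → ¬ G.Adj a b ∧ ∀ c, G.Adj a c → ¬ G.Adj b c) :
    (starGraph G I).IsAcyclic := by
  have key : ∀ a b, a ∈ I → G.Adj a b →
      ¬ ((starGraph G I) \ SimpleGraph.fromEdgeSet {s(a, b)}).Reachable b a := by
    rintro a b ha hab ⟨p⟩
    cases p with
    | nil => exact hab.ne rfl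
    | @cons _ c _ h p =>
      rw [SimpleGraph.sdiff_adj] at h
      obtain ⟨⟨hbc, hor⟩, hn⟩ := h
      have hca : c ≠ a := by
        rintro rfl
        apply hn
        rw [SimpleGraph.fromEdgeSet_adj]
        exact ⟨by simp [Sym2.eq_swap], hbc.ne⟩
      rcases hor with hb | hc
      · exact (hI a ha b hb hab.ne).1 hab
      · exact (hI a ha c hc hca.symm).2 b hab hbc.symm
  rw [SimpleGraph.isAcyclic_iff_forall_isBridge]
  intro e he
  induction e with
  | h a b =>
    have hab : (starGraph G I).Adj a b := he
    rw [SimpleGraph.isBridge_iff]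
    rcases hab.2 with ha | hb
    · exact fun h => key a b ha hab.1 h.symm
    · have := key b a hb hab.1.symm
      rwa [Sym2.eq_swap]

/-- The handshake lemma for trees: vertices of degree at least four force leaves. -/
lemma card_le_card_leaves {W : Type*} [Fintype W] [DecidableEq W] (T : SimpleGraph W)
    [DecidableRel T.Adj] (hT : T.IsTree) (I : Finset W) (hI : ∀ a ∈ I, 4 ≤ T.degree a) :
    I.card ≤ (Finset.univ.filter fun y => T.degree y = 1).card := by
  rcases I.eq_empty_or_nonempty with rfl | ⟨a, ha⟩
  · simp
  have hdeg : 0 < T.degree a := by have := hI a ha; omega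
  obtain ⟨b, hb⟩ := (T.degree_pos_iff_exists_adj a).1 hdeg
  have : Nontrivial W := ⟨a, b, hb.ne⟩
  have h1 := T.sum_degrees_eq_twice_card_edges
  have h2 := hT.card_edgeFinset
  have h3 : ∀ v, (2 : ℤ) * (if v ∈ I then 1 else 0) - (if T.degree v = 1 then 1 else 0) ≤
      (T.degree v : ℤ) - 2 := by
    intro v
    have hpos : 0 < T.degree v := hT.connected.preconnected.degree_pos_of_nontrivial v
    by_cases hv : v ∈ I
    · have := hI v hv
      rw [if_pos hv, if_neg (by omega)]; omega
    · rw [if_neg hv]; split_ifs <;> omega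
  have h4 := Finset.sum_le_sum fun v (_ : v ∈ Finset.univ) => h3 v
  rw [Finset.sum_sub_distrib, Finset.sum_sub_distrib, ← Finset.mul_sum] at h4
  simp only [Finset.sum_boole, Finset.sum_const, Finset.card_univ, nsmul_eq_mul] at h4
  have h5 : (∑ v, (T.degree v : ℤ)) = 2 * T.edgeFinset.card := by exact_mod_cast h1
  rw [h5] at h4
  have h6 : (Finset.univ.filter fun v => v ∈ I) = I := by ext; simp
  rw [h6] at h4
  have h7 : (T.edgeFinset.card : ℤ) + 1 = Fintype.card W := by exact_mod_cast h2
  have : (I.card : ℤ) ≤ ((Finset.univ.filter fun y => T.degree y = 1).card : ℤ) := by linarith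
  exact_mod_cast this

/-- The vertices of `R` with a neighbour outside of `R`. -/
def innerBoundary (G : SimpleGraph V) [DecidableRel G.Adj] (R : Finset V) : Finset V :=
  R.filter fun x => ∃ y, G.Adj x y ∧ y ∉ R

/-- The vertices of `R` whose degree in `G` exceeds two. -/
def branchVertices (G : SimpleGraph V) [DecidableRel G.Adj] (R : Finset V) : Finset V :=
  R.filter fun x => 2 < G.degree x

/-- Stars around a positive fraction of the interior branch vertices extend to a spanning tree; it
has many leaves, all of which are boundary vertices. -/
lemma card_branchVertices_le_of_connected {Δ : ℕ} {ℓ : ℝ} (hG : IsGoodEvenGraph G Δ ℓ)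
    (R : Finset V) (hconn : (G.induce (R : Set V)).Connected) (hR : (R.card : ℝ) < ℓ) :
    (branchVertices G R).card ≤ (1 + (1 + Δ) ^ 2) * (innerBoundary G R).card := by
  classical
  set Int := (branchVertices G R).filter (fun x => x ∉ innerBoundary G R) with hInt
  -- separated sets of interior branch vertices
  let sep : Finset V → Prop := fun I =>
    ∀ a ∈ I, ∀ b ∈ I, a ≠ b → ¬ G.Adj a b ∧ ∀ c, G.Adj a c → ¬ G.Adj b c
  obtain ⟨I, hI, hmax⟩ := Finset.exists_max_image (Int.powerset.filter sep) Finset.card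
    ⟨∅, by simp [sep]⟩
  rw [Finset.mem_filter, Finset.mem_powerset] at hI
  obtain ⟨hIInt, hIsep⟩ := hI
  let N : V → Finset V := fun z => insert z (G.neighborFinset z)
  have hN : ∀ z, (N z).card ≤ 1 + Δ := by
    intro z
    refine (Finset.card_insert_le _ _).trans ?_
    have := hG.degree_le z
    rw [SimpleGraph.card_neighborFinset_eq_degree]; omega
  have hcover : Int ⊆ I.biUnion fun x => (N x).biUnion N := by
    intro x hx
    by_contra hcon
    have hfar : ∀ a ∈ I, x ≠ a ∧ ¬ G.Adj a x ∧ ∀ c, G.Adj a c → ¬ G.Adj x c := by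
      intro a ha
      refine ⟨?_, ?_, ?_⟩
      · rintro rfl
        exact hcon (Finset.mem_biUnion.2 ⟨x, ha,
          Finset.mem_biUnion.2 ⟨x, by simp [N], by simp [N]⟩⟩)
      · intro hax
        exact hcon (Finset.mem_biUnion.2 ⟨a, ha,
          Finset.mem_biUnion.2 ⟨a, by simp [N], by simp [N, hax]⟩⟩)
      · intro c hac hxc
        exact hcon (Finset.mem_biUnion.2 ⟨a, ha, Finset.mem_biUnion.2 ⟨c, by simp [N, hac],
          by simp [N, hxc.symm]⟩⟩)
    have hxI : x ∉ I := fun h => (hfar x h).1 rfl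
    have hmem : insert x I ∈ Int.powerset.filter sep := by
      rw [Finset.mem_filter, Finset.mem_powerset]
      refine ⟨Finset.insert_subset hx hIInt, ?_⟩
      intro a ha b hb hab
      rcases Finset.mem_insert.1 ha with ha' | ha' <;> rcases Finset.mem_insert.1 hb with hb' | hb'
      · exact absurd (ha'.trans hb'.symm) hab
      · subst ha'
        exact ⟨fun h => (hfar b hb').2.1 h.symm, fun c h1 h2 => (hfar b hb').2.2 c h2 h1⟩
      · subst hb'
        exact ⟨(hfar a ha').2.1, (hfar a ha').2.2⟩
      · exact hIsep a ha' b hb' hab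
    have := hmax _ hmem
    rw [Finset.card_insert_of_notMem hxI] at this
    omega
  have hcard1 : Int.card ≤ I.card * (1 + Δ) ^ 2 := by
    refine (Finset.card_le_card hcover).trans (Finset.card_biUnion_le_card_mul _ _ _ fun x _ => ?_)
    rw [sq]
    exact (Finset.card_biUnion_le_card_mul _ _ _ fun z _ => hN z).trans
      (Nat.mul_le_mul_right _ (hN x))
  -- a spanning tree that contains the stars around the vertices of `I`
  let I' : Finset (R : Set V) := Finset.univ.filter fun x => (x : V) ∈ I
  have hI' : ∀ a ∈ I, ∃ h : a ∈ R, (⟨a, h⟩ : (R : Set V)) ∈ I' := by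
    intro a ha
    have h1 := hIInt ha
    simp only [hInt, branchVertices, Finset.mem_filter] at h1
    exact ⟨h1.1.1, by simp [I', ha]⟩
  have hstar : (starGraph (G.induce (R : Set V)) (I' : Set (R : Set V))).IsAcyclic := by
    apply starGraph_isAcyclic
    intro a ha b hb hab
    have ha' : (a : V) ∈ I := by simpa [I'] using ha
    have hb' : (b : V) ∈ I := by simpa [I'] using hb
    have := hIsep a ha' b hb' (fun h => hab (Subtype.ext h))
    exact ⟨this.1, fun c => this.2 c⟩
  obtain ⟨T, hle, hTle, hT⟩ : ∃ T, starGraph (G.induce (R : Set V)) (I' : Set (R : Set V)) ≤ T ∧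
      T ≤ G.induce (R : Set V) ∧ T.IsTree := by
    obtain ⟨T, h1, h2, h3⟩ := hconn.exists_isTree_le_of_le_of_isAcyclic
      (H := starGraph (G.induce (R : Set V)) (I' : Set (R : Set V)))
      (fun a b h => h.1) hstar
    exact ⟨T, h1, h2, h3⟩
  have hdeg : ∀ a ∈ I', 4 ≤ T.degree a := by
    intro a ha
    have ha' : (a : V) ∈ I := by simpa [I'] using ha
    have h1 := hIInt ha'
    simp only [hInt, branchVertices, innerBoundary, Finset.mem_filter, not_and, not_exists,
      not_not] at h1
    obtain ⟨⟨haR, h2⟩, h3⟩ := h1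
    have h4 : 4 ≤ G.degree a := by
      obtain ⟨k, hk⟩ := hG.even_degree a
      omega
    refine h4.trans ?_
    rw [← SimpleGraph.card_neighborFinset_eq_degree, ← SimpleGraph.card_neighborFinset_eq_degree]
    refine Finset.card_le_card_of_surjOn (fun z : (R : Set V) => (z : V)) ?_
    intro b hb
    have hb : G.Adj a b := by simpa using hb
    refine ⟨⟨b, h3 haR b hb⟩, ?_, rfl⟩
    simp only [Finset.mem_coe, SimpleGraph.mem_neighborFinset]
    exact hle ⟨hb, Or.inl ha⟩
  have hleaves := card_le_card_leaves T hT I' hdeg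
  have hIcard : I.card ≤ I'.card := by
    refine Finset.card_le_card_of_surjOn (fun z : (R : Set V) => (z : V)) ?_
    intro a ha
    obtain ⟨h, h'⟩ := hI' a ha
    exact ⟨⟨a, h⟩, h', rfl⟩
  have hX : (Finset.univ.filter fun y => T.degree y = 1).card ≤ (innerBoundary G R).card := by
    refine Finset.card_le_card_of_injOn (fun z : (R : Set V) => (z : V)) ?_
      (fun a _ b _ h => Subtype.ext h)
    intro y hy
    have hy : T.degree y = 1 := by simpa using hy
    by_contra hcon
    have hyR : ∀ w, G.Adj y w → w ∈ (R : Set V) := by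
      intro w hw
      by_contra hwR
      apply hcon
      simp only [innerBoundary, Finset.coe_filter, Set.mem_ofPred_eq]
      exact ⟨y.2, w, hw, hwR⟩
    have := (hG.good y).le_ncard_of_leaf hG.connected T hT.connected hTle y hy hyR
      (hG.even_degree y)
    rw [Set.ncard_coe_finset] at this
    linarith
  have hsplit : (branchVertices G R).card ≤ (innerBoundary G R).card + Int.card := by
    rw [← Finset.card_filter_add_card_filter_not (s := branchVertices G R)
      (fun x => x ∈ innerBoundary G R)]
    refine Nat.add_le_add_right (Finset.card_le_card ?_) _
    intro x hx
    exact (Finset.mem_filter.1 hx).2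
  have : I.card ≤ (innerBoundary G R).card := hIcard.trans (hleaves.trans hX)
  nlinarith [Nat.mul_le_mul_right ((1 + Δ) ^ 2) this]

/-- A set with fewer than `ℓ` vertices which contains a connected set `F` has, up to a constant, at
least as many boundary vertices as `F` has branch vertices. -/
lemma card_branchVertices_le {Δ : ℕ} {ℓ : ℝ} (hG : IsGoodEvenGraph G Δ ℓ) {F R : Finset V}
    (hF : (G.induce (F : Set V)).Connected) (hFR : F ⊆ R) (hR : (R.card : ℝ) < ℓ) :
    (branchVertices G F).card ≤ (1 + (1 + Δ) ^ 2) * (innerBoundary G R).card := by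
  classical
  -- `R'` is the component of `F` in the graph induced on `R`
  obtain ⟨⟨x, hx⟩⟩ := hF.nonempty
  have hxR : x ∈ R := hFR hx
  let R' : Finset V := R.filter fun y =>
    ∃ h : y ∈ R, (G.induce (R : Set V)).Reachable ⟨x, hxR⟩ ⟨y, h⟩
  have hR'R : R' ⊆ R := Finset.filter_subset _ _
  have hFR' : F ⊆ R' := by
    intro y hy
    rw [Finset.mem_filter]
    refine ⟨hFR hy, hFR hy, ?_⟩
    obtain ⟨p⟩ := hF.preconnected ⟨x, hx⟩ ⟨y, hy⟩
    exact ⟨p.map (SimpleGraph.induceHomOfLE G (s := (F : Set V)) (s' := (R : Set V))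
      (by exact_mod_cast hFR)).toHom⟩
  have hconn : (G.induce (R' : Set V)).Connected := by
    have hxR' : x ∈ R' := hFR' hx
    have hwalk : ∀ (a b : (R : Set V)) (p : (G.induce (R : Set V)).Walk a b)
        (ha : (a : V) ∈ R'),
        ∃ hb : (b : V) ∈ R', (G.induce (R' : Set V)).Reachable ⟨a, ha⟩ ⟨b, hb⟩ := by
      intro a b p
      induction p with
      | nil => exact fun ha => ⟨ha, SimpleGraph.Reachable.refl _⟩
      | @cons a c b h p ih =>
        intro ha
        have hc : (c : V) ∈ R' := by
          rw [Finset.mem_filter] at ha ⊢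
          obtain ⟨_, h1, h2⟩ := ha
          exact ⟨c.2, c.2, h2.trans h.reachable⟩
        obtain ⟨hb, hr⟩ := ih hc
        refine ⟨hb, SimpleGraph.Reachable.trans (SimpleGraph.Adj.reachable ?_) hr⟩
        exact h
    rw [SimpleGraph.connected_iff_exists_forall_reachable]
    refine ⟨⟨x, hxR'⟩, ?_⟩
    rintro ⟨y, hy⟩
    have hy' := hy
    simp only [R', Finset.coe_filter, Set.mem_ofPred_eq] at hy'
    obtain ⟨_, h1, ⟨p⟩⟩ := hy'
    obtain ⟨_, hr⟩ := hwalk _ _ p hxR'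
    exact hr
  have h1 := card_branchVertices_le_of_connected hG R' hconn
    (lt_of_le_of_lt (by exact_mod_cast Finset.card_le_card hR'R) hR)
  have h2 : (branchVertices G F).card ≤ (branchVertices G R').card :=
    Finset.card_le_card (Finset.filter_subset_filter _ hFR')
  have h3 : (innerBoundary G R').card ≤ (innerBoundary G R).card := by
    refine Finset.card_le_card fun y hy => ?_
    simp only [innerBoundary, Finset.mem_filter] at hy ⊢
    obtain ⟨hy, z, hyz, hz⟩ := hy
    refine ⟨hR'R hy, z, hyz, fun hzR => hz ?_⟩
    rw [Finset.mem_filter] at hy ⊢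
    obtain ⟨_, h1, h2⟩ := hy
    refine ⟨hzR, hzR, h2.trans (SimpleGraph.Adj.reachable ?_)⟩
    exact hyz
  exact h2.trans (h1.trans (Nat.mul_le_mul_left _ h3))

/-- For `v` at maximal distance from `o`, geodesics from `o` to the neighbours of `v` avoid `v`:
this gives an even subgraph around `v` whose size is at most about `Δ` times the distance. -/
lemma IsGoodEvenGraph.le_dist {Δ : ℕ} {ℓ : ℝ} (hG : IsGoodEvenGraph G Δ ℓ) (o : V) :
    ∃ v, ℓ ≤ 1 + Δ * (G.dist o v + 1) := by
  classical
  obtain ⟨v, _, hv⟩ := Finset.exists_max_image Finset.univ (G.dist o) ⟨o, Finset.mem_univ _⟩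
  refine ⟨v, ?_⟩
  have hw : ∀ w, ∃ p : G.Walk o w, p.length = G.dist o w := fun w =>
    (hG.connected.preconnected o w).exists_walk_length_eq_dist
  choose p hp using hw
  let Q : Finset V := insert v ((G.neighborFinset v).biUnion fun w => (p w).support.toFinset)
  have h1 : ℓ ≤ ((Q : Set V).ncard : ℝ) := by
    refine (hG.good v).le_ncard_of_walks hG.connected (hG.even_degree v) (by simp [Q]) o ?_
    intro w hw
    refine ⟨p w, ?_, ?_⟩
    · intro hmem
      have hlen := congrArg SimpleGraph.Walk.length ((p w).take_spec hmem)
      rw [SimpleGraph.Walk.length_append, hp] at hlen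
      have h2 := SimpleGraph.dist_le ((p w).takeUntil v hmem)
      have h3 : 0 < ((p w).dropUntil v hmem).length := by
        by_contra hcon
        exact hw.ne (SimpleGraph.Walk.eq_of_length_eq_zero
          (p := (p w).dropUntil v hmem) (by omega))
      have := hv w (Finset.mem_univ _)
      omega
    · intro y hy
      simp only [Q, Finset.coe_insert, Finset.coe_biUnion]
      right
      simp only [Set.mem_iUnion]
      exact ⟨w, by simpa using hw, by simpa using hy⟩
  rw [Set.ncard_coe_finset] at h1
  have h2 : Q.card ≤ 1 + Δ * (G.dist o v + 1) := by
    refine (Finset.card_insert_le _ _).trans ?_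
    have : ((G.neighborFinset v).biUnion fun w => (p w).support.toFinset).card ≤
        (G.neighborFinset v).card * (G.dist o v + 1) := by
      refine Finset.card_biUnion_le_card_mul _ _ _ fun w _ => ?_
      refine (List.toFinset_card_le _).trans ?_
      rw [SimpleGraph.Walk.length_support, hp]
      exact Nat.succ_le_succ (hv w (Finset.mem_univ _))
    rw [SimpleGraph.card_neighborFinset_eq_degree] at this
    have := this.trans (Nat.mul_le_mul_right _ (hG.degree_le v))
    omega
  exact h1.trans (by exact_mod_cast h2)

end Isoperimetry

/-! ### The Poincaré inequality from the second eigenvalue -/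

section Poincare

variable {V : Type*} [Fintype V] (G : SimpleGraph V) [DecidableRel G.Adj]

/-- The squared `ℓ²`-norm with respect to the degree measure. -/
def degNormSq (f : V → ℝ) : ℝ := ∑ x, (G.degree x : ℝ) * f x ^ 2

/-- The integral with respect to the degree measure. -/
def degSum (f : V → ℝ) : ℝ := ∑ x, (G.degree x : ℝ) * f x

/-- The total degree `2|E|`, as a real number. -/
def degVol : ℝ := ∑ x, (G.degree x : ℝ)

/-- The bilinear form of the adjacency matrix. -/
def edgeForm (f g : V → ℝ) : ℝ := ∑ x, ∑ y ∈ G.neighborFinset x, f x * g y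

/-- The Dirichlet energy: the sum of the squared increments over the (unoriented) edges. -/
noncomputable def energy (f : V → ℝ) : ℝ :=
  (∑ x, ∑ y ∈ G.neighborFinset x, (f x - f y) ^ 2) / 2

variable {G}

lemma sum_neighbor_comm (F : V → V → ℝ) :
    ∑ x, ∑ y ∈ G.neighborFinset x, F x y = ∑ x, ∑ y ∈ G.neighborFinset x, F y x := by
  rw [Finset.sum_comm' (s' := fun y => G.neighborFinset y) (t' := Finset.univ)]
  intro x y; simp [G.adj_comm]

lemma sum_neighbor_left (F : V → ℝ) :
    ∑ x, ∑ _y ∈ G.neighborFinset x, F x = ∑ x, (G.degree x : ℝ) * F x := by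
  simp

lemma sum_neighbor_right (F : V → ℝ) :
    ∑ x, ∑ y ∈ G.neighborFinset x, F y = ∑ x, (G.degree x : ℝ) * F x := by
  rw [sum_neighbor_comm, sum_neighbor_left]

lemma energy_eq (f : V → ℝ) : energy G f = degNormSq G f - edgeForm G f f := by
  have h : ∀ x y, (f x - f y) ^ 2 = f x ^ 2 + f y ^ 2 - 2 * (f x * f y) := fun x y => by ring
  simp only [energy, degNormSq, edgeForm, h, Finset.sum_add_distrib, Finset.sum_sub_distrib,
    ← Finset.mul_sum]
  rw [sum_neighbor_left (fun x => f x ^ 2), sum_neighbor_right (fun x => f x ^ 2)]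
  ring

lemma energy_nonneg (f : V → ℝ) : 0 ≤ energy G f :=
  div_nonneg (Finset.sum_nonneg fun _ _ => Finset.sum_nonneg fun _ _ => sq_nonneg _) (by norm_num)

lemma degNormSq_nonneg (f : V → ℝ) : 0 ≤ degNormSq G f :=
  Finset.sum_nonneg fun _ _ => mul_nonneg (Nat.cast_nonneg _) (sq_nonneg _)

lemma energy_affine (a b : ℝ) (f : V → ℝ) :
    energy G (fun x => a * f x + b) = a ^ 2 * energy G f := by
  have h : ∀ x y, (a * f x + b - (a * f y + b)) ^ 2 = a ^ 2 * (f x - f y) ^ 2 := fun x y => by ring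
  simp only [energy, h, ← Finset.mul_sum]
  ring

lemma degNormSq_affine (a b : ℝ) (f : V → ℝ) :
    degNormSq G (fun x => a * f x + b) =
      a ^ 2 * degNormSq G f + 2 * a * b * degSum G f + b ^ 2 * degVol G := by
  simp only [degNormSq, degSum, degVol, Finset.mul_sum, ← Finset.sum_add_distrib]
  exact Finset.sum_congr rfl fun x _ => by ring

lemma degSum_affine (a b : ℝ) (f : V → ℝ) :
    degSum G (fun x => a * f x + b) = a * degSum G f + b * degVol G := by
  simp only [degSum, degVol, Finset.mul_sum, ← Finset.sum_add_distrib]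
  exact Finset.sum_congr rfl fun x _ => by ring

/-- Functions of zero energy on a connected graph are constant. -/
lemma eq_of_energy_eq_zero (hG : G.Connected) {f : V → ℝ} (hf : energy G f = 0) (x y : V) :
    f x = f y := by
  have h1 : ∀ x y, G.Adj x y → f x = f y := by
    intro x y hxy
    have h2 : (∑ x, ∑ y ∈ G.neighborFinset x, (f x - f y) ^ 2) = 0 := by
      simp only [energy] at hf; linarith
    have h3 := (Finset.sum_eq_zero_iff_of_nonneg
      (fun x _ => Finset.sum_nonneg fun y _ => sq_nonneg (f x - f y))).1 h2 x (Finset.mem_univ _)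
    have h4 := (Finset.sum_eq_zero_iff_of_nonneg (fun y _ => sq_nonneg (f x - f y))).1 h3 y
      (by simpa using hxy)
    have := pow_eq_zero_iff (two_ne_zero) |>.1 h4
    linarith
  obtain ⟨p⟩ := hG.preconnected x y
  induction p with
  | nil => rfl
  | cons h p ih => exact (h1 _ _ h).trans ih

lemma walkMatrix_mulVec (f : V → ℝ) (x : V) :
    (walkMatrix G).mulVec f x = (1 / (G.degree x : ℝ)) * ∑ y ∈ G.neighborFinset x, f y := by
  simp only [Matrix.mulVec, dotProduct, walkMatrix, Matrix.of_apply, ite_mul, zero_mul]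
  rw [Finset.mul_sum, ← Finset.sum_filter]
  refine Finset.sum_congr ?_ fun _ _ => rfl
  ext y; simp

variable [DecidableEq V]

/-- Every eigenvalue of the simple walk other than `1` is at most `λ_max`, for the simple walk and
for the lazy walk. -/
lemma eigenvalue_le_lambdaMax {P : Matrix V V ℝ} (hP : P = walkMatrix G ∨ P = lazyWalkMatrix G)
    (hlt : lambdaMax P < 1) {a : ℝ} (ha1 : a ≠ 1) {f : V → ℝ} (hf0 : f ≠ 0)
    (hf : (walkMatrix G).mulVec f = a • f) : a ≤ lambdaMax P := by
  have hbdd : ∀ Q : Matrix V V ℝ, BddAbove {r : ℝ | ∃ a : ℝ,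
      Module.End.HasEigenvalue (Matrix.toLin' Q) a ∧ a ≠ 1 ∧ r = |a|} := by
    intro Q
    have hfin : Set.Finite {a : ℝ | Module.End.HasEigenvalue (Matrix.toLin' Q) a} :=
      Module.End.finite_hasEigenvalue _
    refine ((hfin.image fun a => |a|).subset ?_).bddAbove
    rintro r ⟨a, ha, _, rfl⟩
    exact ⟨a, ha, rfl⟩
  rcases hP with rfl | rfl
  · refine (le_abs_self a).trans (le_csSup (hbdd _) ⟨a, ?_, ha1, rfl⟩)
    exact Module.End.hasEigenvalue_of_hasEigenvector
      (x := f) ⟨Module.End.mem_eigenspace_iff.2 (by simpa using hf), hf0⟩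
  · have h1 : (1 + a) / 2 ≤ lambdaMax (lazyWalkMatrix G) := by
      refine (le_abs_self _).trans (le_csSup (hbdd _) ⟨(1 + a) / 2, ?_, ?_, rfl⟩)
      · refine Module.End.hasEigenvalue_of_hasEigenvector
          (x := f) ⟨Module.End.mem_eigenspace_iff.2 ?_, hf0⟩
        rw [Matrix.toLin'_apply, lazyWalkMatrix, Matrix.smul_mulVec, Matrix.add_mulVec,
          Matrix.one_mulVec, hf]
        ext x
        simp only [Pi.smul_apply, Pi.add_apply, smul_eq_mul]
        ring
      · intro h; apply ha1; linarith
    linarith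

lemma lambdaMax_nonneg (P : Matrix V V ℝ) : 0 ≤ lambdaMax P := by
  apply Real.sSup_nonneg
  rintro r ⟨a, _, _, rfl⟩
  exact abs_nonneg a

/-- The Rayleigh quotient bound on functions of mean zero: expand in an eigenbasis of the symmetric
matrix `D^{-1/2} A D^{-1/2}`, in which the eigenvalue `1` is carried by the constants only. -/
lemma edgeForm_le_of_degSum_eq_zero (hG : G.Connected) (hdeg : ∀ x, 0 < G.degree x)
    {P : Matrix V V ℝ} (hP : P = walkMatrix G ∨ P = lazyWalkMatrix G) (hlt : lambdaMax P < 1)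
    {f : V → ℝ} (hf : degSum G f = 0) :
    edgeForm G f f ≤ lambdaMax P * degNormSq G f := by
  have hpos : ∀ x, 0 < √(G.degree x : ℝ) := fun x => Real.sqrt_pos.2 (by exact_mod_cast hdeg x)
  have hsq : ∀ x, √(G.degree x : ℝ) * √(G.degree x : ℝ) = G.degree x := fun x =>
    Real.mul_self_sqrt (Nat.cast_nonneg _)
  let M : Matrix V V ℝ := Matrix.of fun x y =>
    if G.Adj x y then 1 / (√(G.degree x : ℝ) * √(G.degree y : ℝ)) else 0
  have hM : M.IsHermitian := by
    ext x y
    simp [M, G.adj_comm, mul_comm]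
  have hMv : ∀ (h : V → ℝ) x, M.mulVec h x =
      (1 / √(G.degree x : ℝ)) * ∑ y ∈ G.neighborFinset x, h y / √(G.degree y : ℝ) := by
    intro h x
    simp only [Matrix.mulVec, dotProduct, M, Matrix.of_apply, ite_mul, zero_mul]
    rw [Finset.mul_sum, ← Finset.sum_filter]
    refine Finset.sum_congr (by ext y; simp) fun y _ => ?_
    have := hpos x; have := hpos y
    field_simp
  let b := hM.eigenvectorBasis
  let g : EuclideanSpace ℝ V := WithLp.toLp 2 fun x => √(G.degree x : ℝ) * f x
  let Mg : EuclideanSpace ℝ V := WithLp.toLp 2 (M.mulVec g)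
  have hinner : ∀ u w : EuclideanSpace ℝ V, inner ℝ u w = ∑ x, u x * w x := by
    intro u w
    simp [PiLp.inner_apply, mul_comm]
  have h1 : inner ℝ Mg g = edgeForm G f f := by
    rw [hinner]
    simp only [edgeForm]
    refine Finset.sum_congr rfl fun x _ => ?_
    have hx1 : Mg x = M.mulVec g x := rfl
    have hx2 : ∀ y, g y = √(G.degree y : ℝ) * f y := fun _ => rfl
    rw [hx1, hMv]
    simp only [hx2]
    have hx := hpos x
    have : ∑ y ∈ G.neighborFinset x, √(G.degree y : ℝ) * f y / √(G.degree y : ℝ) =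
        ∑ y ∈ G.neighborFinset x, f y :=
      Finset.sum_congr rfl fun y _ => by have := hpos y; field_simp
    rw [this, ← Finset.mul_sum]
    field_simp
  have h2 : inner ℝ g g = degNormSq G f := by
    rw [hinner]
    simp only [degNormSq]
    refine Finset.sum_congr rfl fun x _ => ?_
    have hx2 : g x = √(G.degree x : ℝ) * f x := rfl
    rw [hx2]
    linear_combination (f x ^ 2) * hsq x
  have h3 : ∀ i, inner ℝ Mg (b i) = hM.eigenvalues i * inner ℝ g (b i) := by
    intro i
    have hb : M.mulVec (b i) = hM.eigenvalues i • (b i : V → ℝ) := hM.mulVec_eigenvectorBasis i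
    simp only [EuclideanSpace.inner_eq_star_dotProduct, star_trivial, Mg]
    rw [Matrix.dotProduct_mulVec, ← Matrix.mulVec_transpose]
    have : M.transpose = M := (by simpa using hM : M.IsSymm)
    rw [this, hb, smul_dotProduct, smul_eq_mul]
  have h4 : ∀ i, hM.eigenvalues i * inner ℝ g (b i) ^ 2 ≤ lambdaMax P * inner ℝ g (b i) ^ 2 := by
    intro i
    have hb : M.mulVec (b i) = hM.eigenvalues i • (b i : V → ℝ) := hM.mulVec_eigenvectorBasis i
    let φ : V → ℝ := fun x => b i x / √(G.degree x : ℝ)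
    have hφ : (walkMatrix G).mulVec φ = hM.eigenvalues i • φ := by
      ext x
      have := congrFun hb x
      rw [hMv] at this
      rw [walkMatrix_mulVec]
      simp only [Pi.smul_apply, smul_eq_mul] at this ⊢
      have hx := hpos x
      simp only [φ]
      rw [← mul_div_assoc, ← this, one_div_mul_eq_div, one_div_mul_eq_div, div_div, hsq]
    by_cases ha : hM.eigenvalues i = 1
    · -- the eigenvector is harmonic, hence constant, and orthogonal to `g`
      have he : energy G φ = 0 := by
        rw [energy_eq]
        have : edgeForm G φ φ = degNormSq G φ := by
          simp only [edgeForm, degNormSq]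
          refine Finset.sum_congr rfl fun x _ => ?_
          have := congrFun hφ x
          rw [walkMatrix_mulVec, ha] at this
          simp only [one_smul] at this
          have hx : (0 : ℝ) < G.degree x := by exact_mod_cast hdeg x
          rw [← Finset.mul_sum]
          have h5 : ∑ y ∈ G.neighborFinset x, φ y = G.degree x * φ x := by
            rw [← this]; field_simp
          rw [h5]; ring
        rw [this, sub_self]
      have hc := eq_of_energy_eq_zero hG he
      have : inner ℝ g (b i) = 0 := by
        obtain ⟨z⟩ := hG.nonempty
        rw [hinner]
        calc ∑ x, (√(G.degree x : ℝ) * f x) * (b i) x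
            = ∑ x, φ z * ((G.degree x : ℝ) * f x) := by
              refine Finset.sum_congr rfl fun x _ => ?_
              have := hpos x
              have h6 : φ x * √(G.degree x : ℝ) = b i x := by simp only [φ]; field_simp
              rw [hc z x, ← h6]
              linear_combination (φ x * f x) * hsq x
          _ = 0 := by rw [← Finset.mul_sum]; simp only [degSum] at hf; rw [hf, mul_zero]
      rw [this]; simp
    · refine mul_le_mul_of_nonneg_right (eigenvalue_le_lambdaMax hP hlt ha ?_ hφ) (sq_nonneg _)
      intro h0
      have : b i = 0 := by
        ext x
        have := congrFun h0 x
        simp only [φ, Pi.zero_apply, div_eq_zero_iff] at this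
        exact this.resolve_right (hpos x).ne'
      have hn := b.orthonormal.1 i
      rw [this] at hn
      simp at hn
  rw [← h1, ← h2, ← b.sum_inner_mul_inner Mg g, ← b.sum_inner_mul_inner g g, Finset.mul_sum]
  refine Finset.sum_le_sum fun i _ => ?_
  rw [h3, real_inner_comm g (b i)]
  nlinarith [h4 i]

/-- The Poincaré inequality. -/
lemma poincare (hG : G.Connected) (hdeg : ∀ x, 0 < G.degree x)
    {P : Matrix V V ℝ} (hP : P = walkMatrix G ∨ P = lazyWalkMatrix G) (hlt : lambdaMax P < 1)
    (f : V → ℝ) :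
    (1 - lambdaMax P) * (degNormSq G f - degSum G f ^ 2 / degVol G) ≤ energy G f := by
  have hvol : 0 < degVol G := by
    obtain ⟨z⟩ := hG.nonempty
    exact Finset.sum_pos (fun x _ => by exact_mod_cast hdeg x) ⟨z, Finset.mem_univ _⟩
  set m := degSum G f / degVol G with hm
  have hs : degSum G (fun x => 1 * f x + (-m)) = 0 := by
    rw [degSum_affine, hm]; field_simp; ring
  have h1 := edgeForm_le_of_degSum_eq_zero hG hdeg hP hlt hs
  have h2 := energy_eq (G := G) (fun x => 1 * f x + (-m))
  rw [energy_affine] at h2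
  rw [degNormSq_affine] at h1 h2
  have h3 : 1 ^ 2 * degNormSq G f + 2 * 1 * -m * degSum G f + (-m) ^ 2 * degVol G =
      degNormSq G f - degSum G f ^ 2 / degVol G := by
    rw [hm]; field_simp; ring
  rw [h3] at h1 h2
  linarith

end Poincare

/-! ### Growth of balls and the size of `ℓ` -/

section Growth

variable {V : Type*} [Fintype V] {G : SimpleGraph V} [DecidableRel G.Adj]

/-- The Poincaré inequality with constant `γ` for the degree measure. -/
def HasSpectralGap (G : SimpleGraph V) [DecidableRel G.Adj] (γ : ℝ) : Prop :=
  ∀ f : V → ℝ, γ * (degNormSq G f - degSum G f ^ 2 / degVol G) ≤ energy G f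

lemma degVol_pos [Nonempty V] (hdeg : ∀ x, 0 < G.degree x) : 0 < degVol G :=
  Finset.sum_pos (fun x _ => by exact_mod_cast hdeg x) Finset.univ_nonempty

lemma degVol_le {Δ : ℕ} (hΔ : ∀ x, G.degree x ≤ Δ) : degVol G ≤ Fintype.card V * Δ := by
  refine (Finset.sum_le_card_nsmul _ _ (Δ : ℝ) fun x _ => by exact_mod_cast hΔ x).trans ?_
  simp

/-- On functions supported on at most half of the volume the mean takes away at most half of the
norm. -/
lemma HasSpectralGap.energy_ge_of_support [Nonempty V] (hdeg : ∀ x, 0 < G.degree x) {γ : ℝ}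
    (hγ : 0 ≤ γ) (hP : HasSpectralGap G γ) (A : Finset V)
    (hA : 2 * ∑ x ∈ A, (G.degree x : ℝ) ≤ degVol G) (f : V → ℝ) (hf : ∀ x, x ∉ A → f x = 0) :
    γ / 2 * degNormSq G f ≤ energy G f := by
  have hvol := degVol_pos hdeg
  have h1 : degSum G f = ∑ x ∈ A, (G.degree x : ℝ) * f x :=
    (Finset.sum_subset (Finset.subset_univ A) fun x _ hx => by rw [hf x hx, mul_zero]).symm
  have h2 : degNormSq G f = ∑ x ∈ A, (G.degree x : ℝ) * f x ^ 2 :=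
    (Finset.sum_subset (Finset.subset_univ A) fun x _ hx => by rw [hf x hx]; ring).symm
  have h3 : degSum G f ^ 2 ≤ (∑ x ∈ A, (G.degree x : ℝ)) * degNormSq G f := by
    rw [h1, h2]
    exact Finset.sum_sq_le_sum_mul_sum_of_sq_le_mul A (fun x _ => Nat.cast_nonneg _)
      (fun x _ => mul_nonneg (Nat.cast_nonneg _) (sq_nonneg _)) (fun x _ => le_of_eq (by ring))
  have h4 : degSum G f ^ 2 / degVol G ≤ degNormSq G f / 2 := by
    rw [div_le_div_iff₀ hvol (by norm_num)]
    nlinarith [degNormSq_nonneg (G := G) f]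
  have := hP f
  nlinarith

/-- The total degree of the ball of radius `r` around `a`. -/
noncomputable def ballVol (G : SimpleGraph V) [DecidableRel G.Adj] (a : V) (r : ℕ) : ℝ :=
  ∑ x with G.dist a x ≤ r, (G.degree x : ℝ)

lemma HasSpectralGap.ballVol_growth [Nonempty V] (hG : G.Connected) (hdeg : ∀ x, 0 < G.degree x)
    {γ : ℝ} (hγ : 0 ≤ γ) (hP : HasSpectralGap G γ) (a : V) (r δ : ℕ) (hδ : 0 < δ)
    (hA : 2 * ballVol G a (r + δ) ≤ degVol G) :
    γ / 2 * δ ^ 2 * ballVol G a r ≤ ballVol G a (r + δ) := by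
  have hδ' : (0 : ℝ) < δ := by exact_mod_cast hδ
  -- the tent function of the two balls
  let f : V → ℝ := fun x => max 0 (min 1 (((r : ℝ) + δ - G.dist a x) / δ))
  have hlip : ∀ x y, G.Adj x y → (f x - f y) ^ 2 ≤ 1 / (δ : ℝ) ^ 2 := by
    intro x y hxy
    have h1 : G.dist a x ≤ G.dist a y + 1 := by
      have := hG.dist_triangle (u := a) (v := y) (w := x)
      rwa [SimpleGraph.dist_eq_one_iff_adj.2 hxy.symm] at this
    have h2 : G.dist a y ≤ G.dist a x + 1 := by
      have := hG.dist_triangle (u := a) (v := x) (w := y)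
      rwa [SimpleGraph.dist_eq_one_iff_adj.2 hxy] at this
    have h1' : (G.dist a x : ℝ) ≤ G.dist a y + 1 := by exact_mod_cast h1
    have h2' : (G.dist a y : ℝ) ≤ G.dist a x + 1 := by exact_mod_cast h2
    have h3 : |f x - f y| ≤ 1 / δ := by
      refine (abs_max_sub_max_le_max _ _ _ _).trans (max_le (by simp) ?_)
      refine (abs_min_sub_min_le_max _ _ _ _).trans (max_le (by simp) ?_)
      rw [← sub_div, abs_div, abs_of_pos hδ']
      gcongr
      rw [abs_le]; constructor <;> linarith
    rw [← sq_abs]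
    calc |f x - f y| ^ 2 ≤ (1 / δ) ^ 2 := by gcongr
      _ = 1 / (δ : ℝ) ^ 2 := by ring
  have hsupp : ∀ x, ¬ G.dist a x ≤ r + δ → f x = 0 := by
    intro x hx
    have : ((r : ℝ) + δ) < G.dist a x := by exact_mod_cast not_le.1 hx
    refine max_eq_left (min_le_of_right_le ?_)
    exact div_nonpos_of_nonpos_of_nonneg (by linarith) hδ'.le
  have hone : ∀ x, G.dist a x ≤ r → f x = 1 := by
    intro x hx
    have : (G.dist a x : ℝ) ≤ r := by exact_mod_cast hx
    have h1 : 1 ≤ ((r : ℝ) + δ - G.dist a x) / δ := by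
      rw [le_div_iff₀ hδ']; linarith
    simp [f, min_eq_left h1]
  have h1 := hP.energy_ge_of_support hdeg hγ (Finset.univ.filter fun x => G.dist a x ≤ r + δ) hA f
    (fun x hx => hsupp x (by simpa using hx))
  have h2 : ballVol G a r ≤ degNormSq G f := by
    rw [ballVol, Finset.sum_filter]
    refine Finset.sum_le_sum fun x _ => ?_
    split_ifs with h
    · rw [hone x h]; simp
    · positivity
  have h3 : energy G f ≤ 1 / (δ : ℝ) ^ 2 * ballVol G a (r + δ) := by
    have h4 : ∀ x, ∀ y ∈ G.neighborFinset x, (f x - f y) ^ 2 ≤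
        1 / (δ : ℝ) ^ 2 * ((if G.dist a x ≤ r + δ then 1 else 0) +
          (if G.dist a y ≤ r + δ then 1 else 0)) := by
      intro x y hy
      have hxy : G.Adj x y := by simpa using hy
      have h5 := hlip x y hxy
      have h6 : (0 : ℝ) ≤ 1 / (δ : ℝ) ^ 2 := by positivity
      split_ifs with hx hy' hy'
      · linarith
      · linarith
      · linarith
      · rw [hsupp x hx, hsupp y hy']; simp
    have h5 : energy G f ≤ (∑ x, ∑ y ∈ G.neighborFinset x, 1 / (δ : ℝ) ^ 2 *
        ((if G.dist a x ≤ r + δ then 1 else 0) + (if G.dist a y ≤ r + δ then 1 else 0))) / 2 := by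
      rw [energy]
      gcongr with x _ y hy
      exact h4 x y hy
    refine h5.trans (le_of_eq ?_)
    simp only [← Finset.mul_sum, Finset.sum_add_distrib]
    rw [sum_neighbor_left (fun x => if G.dist a x ≤ r + δ then (1 : ℝ) else 0),
      sum_neighbor_right (fun x => if G.dist a x ≤ r + δ then (1 : ℝ) else 0), ballVol,
      Finset.sum_filter]
    simp only [mul_ite, mul_one, mul_zero]
    ring
  have h7 : γ / 2 * ballVol G a r ≤ 1 / (δ : ℝ) ^ 2 * ballVol G a (r + δ) :=
    (mul_le_mul_of_nonneg_left h2 (by positivity)).trans (h1.trans h3)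
  rw [one_div_mul_eq_div, le_div_iff₀ (by positivity)] at h7
  linarith

lemma ballVol_mono (a : V) {r s : ℕ} (h : r ≤ s) : ballVol G a r ≤ ballVol G a s := by
  refine Finset.sum_le_sum_of_subset_of_nonneg (fun x hx => ?_) fun _ _ _ => Nat.cast_nonneg _
  simp only [Finset.mem_filter, Finset.mem_univ, true_and] at hx ⊢
  omega

lemma HasSpectralGap.two_pow_le_ballVol [Nonempty V] (hG : G.Connected)
    (hdeg : ∀ x, 0 < G.degree x) {γ : ℝ} (hγ : 0 ≤ γ) (hP : HasSpectralGap G γ) (a : V) {ρ δ : ℕ}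
    (hδ : 4 ≤ γ * δ ^ 2) (hA : 2 * ballVol G a ρ ≤ degVol G) (q : ℕ) (hq : q * δ ≤ ρ) :
    (2 : ℝ) ^ q ≤ ballVol G a (q * δ) := by
  have hδ0 : 0 < δ := by
    rcases Nat.eq_zero_or_pos δ with rfl | h
    · norm_num at hδ
    · exact h
  induction q with
  | zero =>
    have : (1 : ℝ) ≤ G.degree a := by exact_mod_cast hdeg a
    simp only [pow_zero, zero_mul, ballVol]
    exact this.trans (Finset.single_le_sum (f := fun x => (G.degree x : ℝ))
      (fun x _ => Nat.cast_nonneg _) (by simp))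
  | succ q ih =>
    have h1 := ih (le_trans (Nat.mul_le_mul_right _ (Nat.le_succ q)) hq)
    have heq : (q + 1) * δ = q * δ + δ := by ring
    rw [heq] at hq ⊢
    have h2 := hP.ballVol_growth hG hdeg hγ a (q * δ) δ hδ0
      ((mul_le_mul_of_nonneg_left (ballVol_mono a hq) (by norm_num)).trans hA)
    have h3 : (0 : ℝ) ≤ 2 ^ q := by positivity
    rw [pow_succ]
    nlinarith

/-- Around one of two distant vertices the balls double up to half of their distance, as they fill
at most half of the volume; this bounds the distance. -/
lemma HasSpectralGap.exists_two_pow_le [Nonempty V] (hG : G.Connected)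
    (hdeg : ∀ x, 0 < G.degree x) {γ : ℝ} (hγ : 0 ≤ γ) (hP : HasSpectralGap G γ) (o v : V) {δ : ℕ}
    (hδ : 4 ≤ γ * δ ^ 2) :
    ∃ q : ℕ, (2 : ℝ) ^ q ≤ degVol G ∧ G.dist o v ≤ 2 * (δ * (q + 1)) + 2 := by
  have hδ0 : 0 < δ := by
    rcases Nat.eq_zero_or_pos δ with rfl | h
    · norm_num at hδ
    · exact h
  by_cases h0 : G.dist o v = 0
  · refine ⟨0, ?_, by omega⟩
    have : (1 : ℝ) ≤ G.degree o := by exact_mod_cast hdeg o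
    rw [pow_zero]
    exact this.trans (Finset.single_le_sum (f := fun x => (G.degree x : ℝ))
      (fun x _ => Nat.cast_nonneg _) (Finset.mem_univ o))
  set ρ := (G.dist o v - 1) / 2 with hρ
  have hdisj : ballVol G o ρ + ballVol G v ρ ≤ degVol G := by
    classical
    rw [ballVol, ballVol, ← Finset.sum_union]
    · exact Finset.sum_le_sum_of_subset_of_nonneg (Finset.subset_univ _)
        fun _ _ _ => Nat.cast_nonneg _
    · rw [Finset.disjoint_left]
      intro x hx hx'
      simp only [Finset.mem_filter, Finset.mem_univ, true_and] at hx hx'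
      have := hG.dist_triangle (u := o) (v := x) (w := v)
      rw [SimpleGraph.dist_comm (u := x)] at this
      omega
  obtain ⟨a, ha⟩ : ∃ a, 2 * ballVol G a ρ ≤ degVol G := by
    rcases le_total (ballVol G o ρ) (ballVol G v ρ) with h | h
    · exact ⟨o, by linarith⟩
    · exact ⟨v, by linarith⟩
  have hq : ρ / δ * δ ≤ ρ := Nat.div_mul_le_self _ _
  refine ⟨ρ / δ, (hP.two_pow_le_ballVol hG hdeg hγ a hδ ha _ hq).trans ?_, ?_⟩
  · exact Finset.sum_le_sum_of_subset_of_nonneg (Finset.subset_univ _)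
        fun _ _ _ => Nat.cast_nonneg _
  · have := Nat.lt_mul_div_succ ρ hδ0
    omega

/-- An `ℓ`-good graph with spectral gap `γ` has `ℓ ≤ C log n / √γ`. -/
lemma IsGoodEvenGraph.mul_sqrt_gap_le [DecidableEq V] {Δ : ℕ} {ℓ : ℝ} (hG : IsGoodEvenGraph G Δ ℓ)
    (hn : 2 ≤ Fintype.card V) (hdeg : ∀ x, 0 < G.degree x) {γ : ℝ} (hγ : 0 < γ) (hγ1 : γ ≤ 1)
    (hP : HasSpectralGap G γ) :
    ℓ * √γ ≤ 40 * Δ ^ 2 * Real.log (Fintype.card V) := by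
  obtain ⟨o⟩ := hG.connected.nonempty
  have : Nonempty V := ⟨o⟩
  obtain ⟨v, hv⟩ := hG.le_dist o
  have hs : 0 < √γ := Real.sqrt_pos.2 hγ
  have hs1 : √γ ≤ 1 := Real.sqrt_le_one.2 hγ1
  have hss : √γ * √γ = γ := Real.mul_self_sqrt hγ.le
  -- the radius increment after which the volume of a ball doubles
  set δ := ⌈2 / √γ⌉₊ with hδdef
  have hδ1 : 2 ≤ √γ * δ := by
    have := Nat.le_ceil (2 / √γ)
    rw [div_le_iff₀ hs] at this
    linarith
  have hδ2 : √γ * δ ≤ 3 := by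
    have h1 := (Nat.ceil_lt_add_one (a := 2 / √γ) (by positivity)).le
    calc √γ * δ ≤ √γ * (2 / √γ + 1) := by gcongr
      _ = 2 + √γ := by field_simp
      _ ≤ 3 := by linarith
  obtain ⟨q, hq, hd⟩ := hP.exists_two_pow_le hG.connected hdeg hγ.le o v (δ := δ)
    (by nlinarith)
  have hΔ : (1 : ℝ) ≤ Δ := by exact_mod_cast (hdeg o).trans_le (hG.degree_le o)
  have hn' : (2 : ℝ) ≤ Fintype.card V := by exact_mod_cast hn
  set L := Real.log (Fintype.card V) with hL
  have hlog2 : (0.69 : ℝ) ≤ Real.log 2 := by linarith [Real.log_two_gt_d9]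
  have hL2 : Real.log 2 ≤ L := Real.log_le_log (by norm_num) hn'
  have hq1 : q * Real.log 2 ≤ L + Δ := by
    have h1 := Real.log_le_log (by positivity) (hq.trans (degVol_le hG.degree_le))
    rw [Real.log_pow, Real.log_mul (by positivity) (by positivity)] at h1
    have h2 := Real.log_le_sub_one_of_pos (show (0 : ℝ) < Δ by linarith)
    linarith
  have hq2 : (q : ℝ) ≤ 3 / 2 * (L + Δ) := by
    have : (0 : ℝ) ≤ q := Nat.cast_nonneg _
    nlinarith
  have hd' : (G.dist o v : ℝ) ≤ 2 * (δ * (q + 1)) + 2 := by exact_mod_cast hd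
  have h1 : ℓ * √γ ≤ (1 + Δ * (2 * (δ * (q + 1)) + 2 + 1)) * √γ := by
    gcongr
    exact hv.trans (by gcongr)
  have h2 : (1 + Δ * (2 * (δ * (q + 1)) + 2 + 1)) * √γ =
      √γ * (1 + 3 * Δ) + 2 * Δ * (q + 1) * (√γ * δ) := by ring
  have h3 : √γ * (1 + 3 * Δ) ≤ 1 * (1 + 3 * Δ) := by gcongr
  have h4 : 2 * Δ * (q + 1) * (√γ * δ) ≤ 2 * Δ * (q + 1 : ℝ) * 3 := by gcongr
  have h5 : (2 : ℝ) * Δ * (q + 1) * 3 ≤ 2 * Δ * (3 / 2 * (L + Δ) + 1) * 3 := by gcongr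
  have hL1 : 1 ≤ 3 / 2 * L := by linarith
  have h6 : (1 : ℝ) + 3 * Δ + 2 * Δ * (3 / 2 * (L + Δ) + 1) * 3 ≤
      10 * Δ ^ 2 + 9 * Δ ^ 2 * L + 9 * Δ ^ 2 := by
    have h7 : (Δ : ℝ) ≤ Δ ^ 2 := by nlinarith
    have h8 : (Δ : ℝ) * L ≤ Δ ^ 2 * L := by gcongr
    nlinarith
  have h7 : (Δ : ℝ) ^ 2 * 1 ≤ Δ ^ 2 * (3 / 2 * L) := by gcongr
  nlinarith

end Growth

/-! ### Capacity of certificates and survival of the random walk -/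

section Capacity

variable {V : Type*} [Fintype V] {G : SimpleGraph V} [DecidableRel G.Adj]

lemma sum_posPart_sq (φ : V → ℝ) :
    ∑ x, ∑ y ∈ G.neighborFinset x, (max (φ x - φ y) 0) ^ 2 = energy G φ := by
  have h := sum_neighbor_comm (G := G) fun x y => (max (φ x - φ y) 0) ^ 2
  have h2 : ∀ x y, (φ x - φ y) ^ 2 = (max (φ x - φ y) 0) ^ 2 + (max (φ y - φ x) 0) ^ 2 := by
    intro x y
    rcases le_total (φ x) (φ y) with h | h
    · rw [max_eq_right (by linarith), max_eq_left (by linarith)]; ring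
    · rw [max_eq_left (by linarith), max_eq_right (by linarith)]; ring
  simp only [energy, h2, Finset.sum_add_distrib]
  rw [← h]; ring

lemma IsGoodEvenGraph.le_card {Δ : ℕ} {ℓ : ℝ} (hG : IsGoodEvenGraph G Δ ℓ) :
    ℓ ≤ Fintype.card V := by
  obtain ⟨o⟩ := hG.connected.nonempty
  have h := hG.good o ⊤ ⟨by simp, by simp, fun x _ => ?_⟩
  · simpa [Set.ncard_univ, Nat.card_eq_fintype_card] using h
  · have : (⊤ : G.Subgraph).neighborSet x = (G.neighborFinset x : Set V) := by ext; simp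
    rw [this, Set.ncard_coe_finset]
    exact hG.even_degree x

/-- Since the adjacency matrix is nonnegative, a bound for its quadratic form on functions
vanishing on `F` also bounds it from below, hence bounds the bilinear form. -/
lemma edgeForm_le_of_dirichlet {F : Finset V} {κ : ℝ}
    (hκ : ∀ g : V → ℝ, (∀ x ∈ F, g x = 0) → κ * degNormSq G g ≤ energy G g)
    (f g : V → ℝ) (hf : ∀ x ∈ F, f x = 0) (hg : ∀ x ∈ F, g x = 0) :
    edgeForm G f g ≤ (1 - κ) / 2 * (degNormSq G f + degNormSq G g) := by
  have h1 : ∀ h : V → ℝ, (∀ x ∈ F, h x = 0) → edgeForm G h h ≤ (1 - κ) * degNormSq G h := by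
    intro h hh
    have := hκ h hh
    rw [energy_eq] at this
    linarith
  have h2 : ∀ h : V → ℝ, (∀ x ∈ F, h x = 0) → -edgeForm G h h ≤ (1 - κ) * degNormSq G h := by
    intro h hh
    have h3 := h1 (fun x => |h x|) fun x hx => by simp [hh x hx]
    have h4 : degNormSq G (fun x => |h x|) = degNormSq G h := by simp [degNormSq]
    rw [h4] at h3
    refine le_trans ?_ h3
    simp only [edgeForm]
    rw [← Finset.sum_neg_distrib]
    refine Finset.sum_le_sum fun x _ => ?_
    rw [← Finset.sum_neg_distrib]
    refine Finset.sum_le_sum fun y _ => ?_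
    rw [← abs_mul]
    exact neg_le_abs _
  have h5 := h1 (fun x => f x + g x) fun x hx => by simp [hf x hx, hg x hx]
  have h6 := h2 (fun x => f x - g x) fun x hx => by simp [hf x hx, hg x hx]
  have h7 : edgeForm G (fun x => f x + g x) (fun x => f x + g x) -
      edgeForm G (fun x => f x - g x) (fun x => f x - g x) = 4 * edgeForm G f g := by
    have hcomm : edgeForm G g f = edgeForm G f g := by
      simp only [edgeForm]
      rw [sum_neighbor_comm]
      exact Finset.sum_congr rfl fun x _ => Finset.sum_congr rfl fun y _ => mul_comm _ _
    have : ∀ x y, (f x + g x) * (f y + g y) - (f x - g x) * (f y - g y) =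
        2 * (f x * g y) + 2 * (g x * f y) := fun x y => by ring
    calc _ = 2 * edgeForm G f g + 2 * edgeForm G g f := by
          simp only [edgeForm, ← Finset.sum_sub_distrib, this, Finset.sum_add_distrib,
            Finset.mul_sum]
      _ = _ := by rw [hcomm]; ring
  have h8 : degNormSq G (fun x => f x + g x) + degNormSq G (fun x => f x - g x) =
      2 * (degNormSq G f + degNormSq G g) := by
    simp only [degNormSq, ← Finset.sum_add_distrib, Finset.mul_sum]
    exact Finset.sum_congr rfl fun x _ => by ring
  have h9 : (1 - κ) * degNormSq G (fun x => f x + g x) +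
      (1 - κ) * degNormSq G (fun x => f x - g x) =
      (1 - κ) * (2 * (degNormSq G f + degNormSq G g)) := by rw [← mul_add, h8]
  linarith

variable [DecidableEq V]

/-- The coarea inequality: if all superlevel sets of `φ` at levels in `[1/2, 1)` have at least `b`
boundary vertices, then the increments of `φ` along edges above level `1/2` sum to at least
`b/2`. -/
lemma coarea (φ : V → ℝ) (b : ℝ)
    (hb : ∀ s ∈ Set.Ico (1 / 2 : ℝ) 1,
      b ≤ (innerBoundary G (Finset.univ.filter fun x => s < φ x)).card) :
    b / 2 ≤ ∑ x with 1 / 2 < φ x, ∑ y ∈ G.neighborFinset x, max (φ x - φ y) 0 := by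
  have h1 : ∀ s, ((innerBoundary G (Finset.univ.filter fun x => s < φ x)).card : ℝ) ≤
      ∑ x, ∑ y ∈ G.neighborFinset x, (Set.Ico (φ y) (φ x)).indicator 1 s := by
    intro s
    have h0 : ∀ x y, (0 : ℝ) ≤ (Set.Ico (φ y) (φ x)).indicator 1 s :=
      fun x y => Set.indicator_nonneg (fun _ _ => zero_le_one) _
    rw [Finset.card_eq_sum_ones, Nat.cast_sum, innerBoundary, Finset.sum_filter, Finset.sum_filter]
    refine Finset.sum_le_sum fun x _ => ?_
    split_ifs with hx hy
    · obtain ⟨y, hxy, hy⟩ := hy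
      refine le_trans ?_ (Finset.single_le_sum (fun y _ => h0 x y)
        (by simpa using hxy : y ∈ G.neighborFinset x))
      rw [Set.indicator_of_mem]
      · simp
      · exact ⟨by simpa using hy, hx⟩
    · exact Finset.sum_nonneg fun y _ => h0 x y
    · exact Finset.sum_nonneg fun y _ => h0 x y
  have hint : ∀ x y, Integrable (fun s => (Set.Ico (φ y) (φ x)).indicator (1 : ℝ → ℝ) s)
      (volume.restrict (Set.Ico (1 / 2 : ℝ) 1)) := fun x y =>
    (integrable_const (1 : ℝ)).indicator measurableSet_Ico
  have h2 : ∫ _s in Set.Ico (1 / 2 : ℝ) 1, b ≤ ∫ s in Set.Ico (1 / 2 : ℝ) 1,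
      ∑ x, ∑ y ∈ G.neighborFinset x, (Set.Ico (φ y) (φ x)).indicator (1 : ℝ → ℝ) s := by
    refine setIntegral_mono_on (integrable_const b) ?_ measurableSet_Ico
      fun s hs => (hb s hs).trans (h1 s)
    exact integrable_finsetSum _ fun x _ => integrable_finsetSum _ fun y _ => hint x y
  rw [integral_finsetSum _ fun x _ => integrable_finsetSum _ fun y _ => hint x y] at h2
  have h3 : ∫ _s in Set.Ico (1 / 2 : ℝ) 1, b = b / 2 := by
    rw [setIntegral_const]
    simp [Measure.real, Real.volume_Ico]
    rw [ENNReal.toReal_ofReal (by norm_num)]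
    ring
  rw [h3] at h2
  refine h2.trans ?_
  rw [Finset.sum_filter]
  refine Finset.sum_le_sum fun x _ => ?_
  rw [integral_finsetSum _ fun y _ => hint x y]
  have h4 : ∀ y, ∫ s in Set.Ico (1 / 2 : ℝ) 1, (Set.Ico (φ y) (φ x)).indicator (1 : ℝ → ℝ) s =
      (volume (Set.Ico (φ y) (φ x) ∩ Set.Ico (1 / 2 : ℝ) 1)).toReal := by
    intro y
    rw [integral_indicator_one measurableSet_Ico, Measure.real,
      Measure.restrict_apply measurableSet_Ico]
  split_ifs with hx
  · refine Finset.sum_le_sum fun y _ => ?_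
    rw [h4]
    calc (volume (Set.Ico (φ y) (φ x) ∩ Set.Ico (1 / 2 : ℝ) 1)).toReal
        ≤ (volume (Set.Ico (φ y) (φ x))).toReal :=
          ENNReal.toReal_mono (by simp) (measure_mono Set.inter_subset_left)
      _ = max (φ x - φ y) 0 := by rw [Real.volume_Ico, ENNReal.toReal_ofReal']
  · refine Finset.sum_nonpos fun y _ => ?_
    rw [h4]
    have : Set.Ico (φ y) (φ x) ∩ Set.Ico (1 / 2 : ℝ) 1 = ∅ := by
      ext s
      simp only [Set.mem_inter_iff, Set.mem_Ico, Set.mem_empty_iff_false, iff_false, not_and]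
      intro h h'
      linarith
    rw [this]; simp

/-- The sets used to certify that a vertex is unvisited: either large, or connected with many branch
vertices. -/
def IsCertificate (G : SimpleGraph V) [DecidableRel G.Adj] (ℓ : ℝ) (J : ℕ) (F : Finset V) : Prop :=
  ℓ ≤ F.card ∨ (G.induce (F : Set V)).Connected ∧ J ≤ (branchVertices G F).card

/-- The capacity of a certificate, for the walk killed at rate `γ`, is at least `γℓ/4`. -/
lemma IsGoodEvenGraph.capacity_ge {Δ : ℕ} {ℓ : ℝ} (hℓ : 0 < ℓ) (hG : IsGoodEvenGraph G Δ ℓ)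
    (hdeg : ∀ x, 0 < G.degree x) {γ : ℝ} (hγ : 0 < γ) {J : ℕ}
    (hJ : (1 + (1 + Δ) ^ 2) * Δ * (ℓ * √γ) ≤ J) {F : Finset V} (hF : IsCertificate G ℓ J F)
    (φ : V → ℝ) (hφ : ∀ x ∈ F, φ x = 1) :
    γ * ℓ / 4 ≤ energy G φ + γ * degNormSq G φ := by
  have hdeg' : ∀ x, (1 : ℝ) ≤ G.degree x := fun x => by exact_mod_cast hdeg x
  set U : Finset V := Finset.univ.filter fun x => 1 / 2 < φ x with hU
  have hFU : ∀ s < (1 : ℝ), F ⊆ Finset.univ.filter fun x => s < φ x := by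
    intro s hs x hx
    simp [hφ x hx, hs]
  by_cases hbig : ℓ ≤ U.card
  · have h1 : ℓ / 4 ≤ degNormSq G φ := by
      calc ℓ / 4 ≤ U.card * (1 / 4) := by linarith
        _ = ∑ x ∈ U, (1 / 4 : ℝ) := by simp
        _ ≤ ∑ x ∈ U, (G.degree x : ℝ) * φ x ^ 2 := by
          refine Finset.sum_le_sum fun x hx => ?_
          have hx : 1 / 2 < φ x := by simpa [hU] using hx
          have := hdeg' x
          nlinarith [mul_le_mul_of_nonneg_right this (sq_nonneg (φ x))]
        _ ≤ degNormSq G φ := Finset.sum_le_sum_of_subset_of_nonneg (Finset.subset_univ _)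
            fun _ _ _ => by positivity
    have := energy_nonneg (G := G) φ
    nlinarith
  have hsmall : (U.card : ℝ) < ℓ := not_le.1 hbig
  rcases hF with hF | ⟨hconn, hbr⟩
  · exact absurd (hF.trans (by exact_mod_cast Finset.card_le_card (hFU (1 / 2) (by norm_num)))) hbig
  -- all superlevel sets above level `1/2` have fewer than `ℓ` vertices
  set K : ℝ := 1 + (1 + Δ) ^ 2 with hK
  have hKpos : 0 < K := by positivity
  have hco := coarea (G := G) φ (J / K) (by
    intro s hs
    have hR : (((Finset.univ.filter fun x => s < φ x).card : ℕ) : ℝ) < ℓ := by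
      refine lt_of_le_of_lt ?_ hsmall
      have : (Finset.univ.filter fun x => s < φ x) ⊆ U := by
        intro x hx
        simp only [hU, Finset.mem_filter, Finset.mem_univ, true_and] at hx ⊢
        linarith [hs.1]
      exact_mod_cast Finset.card_le_card this
    have h1 := hbr.trans (card_branchVertices_le hG hconn (hFU s hs.2) hR)
    rw [div_le_iff₀ hKpos, mul_comm, hK]
    exact_mod_cast h1)
  set S := ∑ x ∈ U, ∑ y ∈ G.neighborFinset x, max (φ x - φ y) 0 with hS
  -- Cauchy-Schwarz over the edges that meet `U`
  have hCS : S ^ 2 ≤ (Δ * ℓ) * energy G φ := by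
    have h1 : S = ∑ p ∈ U.sigma fun x => G.neighborFinset x, max (φ p.1 - φ p.2) 0 := by
      rw [Finset.sum_sigma]
    have h2 := sq_sum_le_card_mul_sum_sq (s := U.sigma fun x => G.neighborFinset x)
      (f := fun p => max (φ p.1 - φ p.2) 0)
    rw [← h1] at h2
    have h3 : (((U.sigma fun x => G.neighborFinset x).card : ℕ) : ℝ) ≤ Δ * ℓ := by
      rw [Finset.card_sigma]
      have : ∑ x ∈ U, (G.neighborFinset x).card ≤ U.card * Δ := by
        refine (Finset.sum_le_card_nsmul _ _ Δ fun x _ => ?_).trans (by simp)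
        rw [SimpleGraph.card_neighborFinset_eq_degree]
        exact hG.degree_le x
      calc ((∑ x ∈ U, (G.neighborFinset x).card : ℕ) : ℝ) ≤ U.card * Δ := by exact_mod_cast this
        _ ≤ ℓ * Δ := by gcongr
        _ = Δ * ℓ := mul_comm _ _
    have h4 : ∑ p ∈ U.sigma fun x => G.neighborFinset x, (max (φ p.1 - φ p.2) 0) ^ 2 ≤
        energy G φ := by
      rw [Finset.sum_sigma, ← sum_posPart_sq]
      exact Finset.sum_le_sum_of_subset_of_nonneg (Finset.subset_univ _)
        fun _ _ _ => Finset.sum_nonneg fun _ _ => sq_nonneg _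
    refine h2.trans (mul_le_mul h3 h4 (Finset.sum_nonneg fun _ _ => sq_nonneg _) (by positivity))
  have hΔ : (1 : ℝ) ≤ Δ := by
    obtain ⟨o⟩ := hG.connected.nonempty
    exact (hdeg' o).trans (by exact_mod_cast hG.degree_le o)
  have hJK : Δ * (ℓ * √γ) ≤ J / K := by
    rw [le_div_iff₀ hKpos]
    linarith
  have hSle : Δ * (ℓ * √γ) / 2 ≤ S := by linarith
  have hsq : (Δ * (ℓ * √γ) / 2) ^ 2 ≤ S ^ 2 := by gcongr
  have hss : √γ ^ 2 = γ := Real.sq_sqrt hγ.le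
  have h5 : (Δ * ℓ) * (Δ * (γ * ℓ / 4)) ≤ (Δ * ℓ) * energy G φ := by
    calc (Δ * ℓ) * (Δ * (γ * ℓ / 4)) = (Δ * (ℓ * √γ) / 2) ^ 2 := by
          linear_combination (-(Δ ^ 2 * ℓ ^ 2) / 4 : ℝ) * hss
      _ ≤ _ := hsq.trans hCS
  have h6 := le_of_mul_le_mul_left h5 (by positivity)
  have h7 : γ * ℓ / 4 ≤ Δ * (γ * ℓ / 4) := le_mul_of_one_le_left (by positivity) hΔ
  have := mul_nonneg hγ.le (degNormSq_nonneg (G := G) φ)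
  linarith

/-- The bound on the Dirichlet eigenvalue of the complement of a certificate. -/
lemma IsGoodEvenGraph.dirichlet_ge {Δ : ℕ} {ℓ : ℝ} (hℓ : 0 < ℓ) (hG : IsGoodEvenGraph G Δ ℓ)
    (hdeg : ∀ x, 0 < G.degree x) {γ : ℝ} (hγ : 0 < γ) (hP : HasSpectralGap G γ) {J : ℕ}
    (hJ : (1 + (1 + Δ) ^ 2) * Δ * (ℓ * √γ) ≤ J) {F : Finset V} (hF : IsCertificate G ℓ J F)
    (g : V → ℝ) (hg : ∀ x ∈ F, g x = 0) :
    γ * ℓ / (16 * (Fintype.card V * Δ)) * degNormSq G g ≤ energy G g := by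
  obtain ⟨o⟩ := hG.connected.nonempty
  have : Nonempty V := ⟨o⟩
  have hn : (0 : ℝ) < Fintype.card V := by exact_mod_cast Fintype.card_pos
  have hΔ : (1 : ℝ) ≤ Δ := by exact_mod_cast (hdeg o).trans_le (hG.degree_le o)
  have hvol := degVol_pos hdeg
  have hvol' := degVol_le (G := G) hG.degree_le
  set A := degNormSq G g with hA
  have hA0 : 0 ≤ A := degNormSq_nonneg g
  set m := degSum G g / degVol G with hm
  have hmv : degSum G g ^ 2 / degVol G = degVol G * m ^ 2 := by rw [hm]; field_simp
  have hpo := hP g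
  rw [hmv] at hpo
  set κ := γ * ℓ / (16 * (Fintype.card V * Δ)) with hκ
  rcases le_total (degVol G * m ^ 2) (A / 2) with hcase | hcase
  · have h1 : κ ≤ γ / 2 := by
      rw [hκ, div_le_div_iff₀ (by positivity) (by norm_num)]
      have h2 : ℓ ≤ Fintype.card V * Δ := hG.le_card.trans (le_mul_of_one_le_right hn.le hΔ)
      nlinarith [mul_le_mul_of_nonneg_left h2 hγ.le, mul_pos hγ hℓ]
    calc κ * A ≤ γ / 2 * A := by gcongr
      _ = γ * (A - A / 2) := by ring
      _ ≤ γ * (A - degVol G * m ^ 2) := by gcongr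
      _ ≤ _ := hpo
  · by_cases hm0 : m = 0
    · rw [hm0] at hcase
      have : A = 0 := by nlinarith
      rw [this, mul_zero]
      exact energy_nonneg g
    -- the function `1 - g / m` is a competitor for the capacity
    have hcap := hG.capacity_ge hℓ hdeg hγ hJ hF (fun x => (-m⁻¹) * g x + 1)
      (fun x hx => by rw [hg x hx]; simp)
    have hm2 : 0 < m ^ 2 := by positivity
    rw [energy_affine, degNormSq_affine] at hcap
    have h1 : (-m⁻¹) ^ 2 * degNormSq G g + 2 * -m⁻¹ * 1 * degSum G g + 1 ^ 2 * degVol G =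
        (A - degVol G * m ^ 2) / m ^ 2 := by
      have : degSum G g = m * degVol G := by rw [hm]; field_simp
      rw [this]; field_simp; ring
    rw [h1, neg_sq, inv_pow, inv_mul_eq_div, ← mul_div_assoc, ← add_div,
      le_div_iff₀ hm2] at hcap
    have h2 : A / (2 * (Fintype.card V * Δ)) ≤ m ^ 2 := by
      rw [div_le_iff₀ (by positivity)]
      nlinarith [mul_le_mul_of_nonneg_right hvol' hm2.le]
    have h3 : κ * A = γ * ℓ / 4 * (A / (2 * (Fintype.card V * Δ))) / 2 := by
      rw [hκ]; field_simp; ring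
    have h4 : γ * ℓ / 4 * (A / (2 * (Fintype.card V * Δ))) ≤ γ * ℓ / 4 * m ^ 2 := by gcongr
    rw [h3]
    linarith

/-- `survival G F t x` is the probability that the simple random walk started at `x` is not in `F`
at any of the times `0, …, t - 1`. -/
noncomputable def survival (G : SimpleGraph V) [DecidableRel G.Adj] (F : Finset V) : ℕ → V → ℝ
  | 0, _ => 1
  | t + 1, x => if x ∈ F then 0 else
      (1 / (G.degree x : ℝ)) * ∑ y ∈ G.neighborFinset x, survival G F t y

lemma survival_nonneg (F : Finset V) (t : ℕ) (x : V) : 0 ≤ survival G F t x := by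
  induction t generalizing x with
  | zero => simp [survival]
  | succ t ih =>
    rw [survival]
    split_ifs
    · exact le_rfl
    · exact mul_nonneg (by positivity) (Finset.sum_nonneg fun y _ => ih y)

lemma survival_le_one (F : Finset V) (t : ℕ) (x : V) : survival G F t x ≤ 1 := by
  induction t generalizing x with
  | zero => simp [survival]
  | succ t ih =>
    rw [survival]
    split_ifs
    · exact zero_le_one
    · have h1 : ∑ y ∈ G.neighborFinset x, survival G F t y ≤ G.degree x :=
        (Finset.sum_le_card_nsmul _ _ 1 fun y _ => ih y).trans (by simp)
      rw [one_div_mul_eq_div]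
      exact div_le_one_of_le₀ h1 (Nat.cast_nonneg _)

/-- The `ℓ²`-norm of the survival probability decays by the factor `1 - κ` in each step
after the first. -/
lemma survival_le {F : Finset V} {κ : ℝ} (hκ1 : κ < 1) (hdeg : ∀ x, 0 < G.degree x)
    (hκ : ∀ g : V → ℝ, (∀ x ∈ F, g x = 0) → κ * degNormSq G g ≤ energy G g) (t : ℕ) (x : V) :
    survival G F (t + 1) x ≤ degVol G * (1 - κ) ^ t := by
  have hvan : ∀ t, ∀ x ∈ F, survival G F (t + 1) x = 0 := fun t x hx => by rw [survival, if_pos hx]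
  have hρ : 0 < 1 - κ := by linarith
  have hstep : ∀ t, degNormSq G (survival G F (t + 2)) ≤
      (1 - κ) ^ 2 * degNormSq G (survival G F (t + 1)) := by
    intro t
    set g := survival G F (t + 1) with hg
    set g' := survival G F (t + 2) with hg'
    have h1 : degNormSq G g' = edgeForm G g' g := by
      simp only [degNormSq, edgeForm]
      refine Finset.sum_congr rfl fun x _ => ?_
      rw [← Finset.mul_sum]
      by_cases hx : x ∈ F
      · rw [hg', hvan (t + 1) x hx]; ring
      · have h2 : g' x = (1 / (G.degree x : ℝ)) * ∑ y ∈ G.neighborFinset x, g y := by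
          rw [hg', survival, if_neg hx]
        have h3 : (0 : ℝ) < G.degree x := by exact_mod_cast hdeg x
        have h4 : ∑ y ∈ G.neighborFinset x, g y = G.degree x * g' x := by
          rw [h2]; field_simp
        rw [h4]; ring
    have h2 := edgeForm_le_of_dirichlet hκ g' (fun x => (1 - κ) * g x + 0) (hvan (t + 1))
      (fun x hx => by rw [hg, hvan t x hx]; ring)
    have h3 : edgeForm G g' (fun x => (1 - κ) * g x + 0) = (1 - κ) * edgeForm G g' g := by
      simp only [edgeForm, Finset.mul_sum]
      exact Finset.sum_congr rfl fun x _ => Finset.sum_congr rfl fun y _ => by ring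
    rw [h3, degNormSq_affine, ← h1] at h2
    have h4 : (1 - κ) * degNormSq G g' ≤ (1 - κ) * ((1 - κ) ^ 2 * degNormSq G g) := by nlinarith
    exact le_of_mul_le_mul_left h4 hρ
  have h1 : ∀ t, degNormSq G (survival G F (t + 1)) ≤ degVol G * (1 - κ) ^ (2 * t) := by
    intro t
    induction t with
    | zero =>
      simp only [degNormSq, degVol, mul_zero, pow_zero, mul_one]
      refine Finset.sum_le_sum fun x _ => ?_
      have h1 := survival_nonneg (G := G) F (0 + 1) x
      have h2 := survival_le_one (G := G) F (0 + 1) x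
      have h3 : (0 : ℝ) ≤ G.degree x := Nat.cast_nonneg _
      have h4 : survival G F (0 + 1) x ^ 2 ≤ 1 := by nlinarith
      nlinarith
    | succ t ih =>
      refine (hstep t).trans ?_
      calc (1 - κ) ^ 2 * degNormSq G (survival G F (t + 1))
          ≤ (1 - κ) ^ 2 * (degVol G * (1 - κ) ^ (2 * t)) := by gcongr
        _ = _ := by ring
  have hx : (1 : ℝ) ≤ G.degree x := by exact_mod_cast hdeg x
  have h2 : survival G F (t + 1) x ^ 2 ≤ degNormSq G (survival G F (t + 1)) := by
    refine le_trans ?_ (Finset.single_le_sum (fun y _ => by positivity) (Finset.mem_univ x))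
    nlinarith [sq_nonneg (survival G F (t + 1) x)]
  have hvol : 1 ≤ degVol G :=
    hx.trans (Finset.single_le_sum (f := fun x => (G.degree x : ℝ))
      (fun x _ => Nat.cast_nonneg _) (Finset.mem_univ x))
  have h3 : survival G F (t + 1) x ^ 2 ≤ (degVol G * (1 - κ) ^ t) ^ 2 := by
    refine (h2.trans (h1 t)).trans ?_
    rw [mul_pow, ← pow_mul, mul_comm t 2]
    gcongr
    nlinarith
  exact le_of_sq_le_sq h3 (by positivity)

end Capacity

/-! ### Counting certificates -/

section Certificates

variable {V : Type*} {G : SimpleGraph V}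

lemma connected_induce_insert [DecidableEq V] {A : Finset V}
    (hA : (G.induce (A : Set V)).Connected) {x w : V} (hx : x ∈ A) (hxw : G.Adj x w) : (G.induce ((insert w A : Finset V) : Set V)).Connected := by
  rw [SimpleGraph.connected_iff_exists_forall_reachable]
  have hle : (A : Set V) ⊆ ((insert w A : Finset V) : Set V) := by
    exact_mod_cast Finset.subset_insert w A
  refine ⟨⟨x, hle hx⟩, ?_⟩
  rintro ⟨y, hy⟩
  rcases Finset.mem_insert.1 (Finset.mem_coe.1 hy) with rfl | hy'
  · exact SimpleGraph.Adj.reachable hxw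
  · obtain ⟨p⟩ := hA.preconnected ⟨x, hx⟩ ⟨y, hy'⟩
    exact ⟨p.map (SimpleGraph.induceHomOfLE G hle).toHom⟩

/-- The even subgraphs `S` of `G` whose component of `v` contains `A` and has at least `ℓ` vertices,
and which agree with the template `S₀` at the vertices of `A`. -/
structure IsExploredBy (G : SimpleGraph V) (ℓ : ℝ) (v : V) (A : Finset V) (S₀ S : SimpleGraph V) :
    Prop where
  le : S ≤ G
  even : ∀ x, Even (S.neighborSet x).ncard
  agree : ∀ a ∈ A, ∀ y, S.Adj a y ↔ S₀.Adj a y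
  reachable : ∀ a ∈ A, S.Reachable v a
  large : ℓ ≤ ({y | S.Reachable v y}.ncard : ℝ)

variable [Fintype V]

lemma IsExploredBy.exists_boundary {ℓ : ℝ} {v : V} {A : Finset V} {S₀ S : SimpleGraph V}
    (hS : IsExploredBy G ℓ v A S₀ S) (hA : A.Nonempty) (hcard : (A.card : ℝ) < ℓ) :
    ∃ x ∈ A, ∃ w ∉ A, S.Adj x w := by
  obtain ⟨a, ha⟩ := hA
  obtain ⟨y, hy, hyA⟩ : ∃ y, S.Reachable v y ∧ y ∉ A := by
    by_contra hcon
    push Not at hcon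
    have : {y | S.Reachable v y}.ncard ≤ A.card := by
      rw [← Set.ncard_coe_finset]
      exact Set.ncard_le_ncard (fun y hy => hcon y hy) (Set.toFinite _)
    have h2 : ({y | S.Reachable v y}.ncard : ℝ) ≤ A.card := by exact_mod_cast this
    linarith [hS.large]
  obtain ⟨p⟩ := (hS.reachable a ha).symm.trans hy
  obtain ⟨d, _, h1, h2⟩ := p.exists_boundary_dart (A : Set V) ha hyA
  exact ⟨d.fst, h1, d.snd, h2, d.adj⟩

variable [DecidableRel G.Adj]

/-- If `w` has degree two, then an even subgraph with an edge at `w` contains both. -/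
lemma IsExploredBy.adj_iff_of_degree_le_two {ℓ : ℝ} {v : V} {A : Finset V} {S₀ S : SimpleGraph V}
    (hS : IsExploredBy G ℓ v A S₀ S) {x w : V} (hw : G.degree w ≤ 2) (hxw : S.Adj x w) (y : V) :
    S.Adj w y ↔ G.Adj w y := by
  have hsub : S.neighborSet w ⊆ (G.neighborFinset w : Set V) := by
    intro z hz
    simpa using hS.le hz
  have hle : ((G.neighborFinset w : Set V)).ncard ≤ (S.neighborSet w).ncard := by
    rw [Set.ncard_coe_finset, SimpleGraph.card_neighborFinset_eq_degree]
    have hpos : 0 < (S.neighborSet w).ncard :=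
      (Set.ncard_pos (Set.toFinite _)).2 ⟨x, hxw.symm⟩
    obtain ⟨k, hk⟩ := hS.even w
    omega
  have heq := Set.eq_of_subset_of_ncard_le hsub hle (Set.toFinite _)
  have := Set.ext_iff.1 heq y
  simpa using this

variable [DecidableEq V]

/-- Exploring the component of `v` in an even subgraph, vertex by vertex, only the branch vertices
reveal information: this bounds the number of certificates needed. -/
lemma exists_certificates_of_explored {Δ : ℕ} {ℓ : ℝ} (hΔ : ∀ x, G.degree x ≤ Δ) (J : ℕ) (v : V) :
    ∀ (k : ℕ) (A : Finset V) (S₀ : SimpleGraph V), Fintype.card V - A.card < k →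
      (G.induce (A : Set V)).Connected →
      ∃ 𝓕 : Finset (Finset V), 𝓕.card ≤ (2 ^ Δ) ^ (J - (branchVertices G A).card) ∧
        (∀ F ∈ 𝓕, IsCertificate G ℓ J F) ∧
        ∀ S, IsExploredBy G ℓ v A S₀ S → ∃ F ∈ 𝓕, ∀ y ∈ F, S.Reachable v y := by
  classical
  intro k
  induction k with
  | zero =>
    exact fun A S₀ hk => absurd hk (Nat.not_lt_zero _)
  | succ k ih =>
    intro A S₀ hk hA
    have hAne : A.Nonempty := by
      obtain ⟨⟨a, ha⟩⟩ := hA.nonempty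
      exact ⟨a, ha⟩
    by_cases hdone : ℓ ≤ A.card ∨ J ≤ (branchVertices G A).card
    · refine ⟨{A}, by simpa using Nat.one_le_pow _ _ (by positivity), ?_, ?_⟩
      · intro F hF
        rw [Finset.mem_singleton.1 hF]
        exact hdone.imp id fun h => ⟨hA, h⟩
      · intro S hS
        exact ⟨A, by simp, hS.reachable⟩
    push Not at hdone
    obtain ⟨hcard, hb⟩ := hdone
    by_cases hex : ∃ S, IsExploredBy G ℓ v A S₀ S
    swap
    · exact ⟨∅, by simp, by simp, fun S hS => absurd ⟨S, hS⟩ hex⟩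
    obtain ⟨S₁, hS₁⟩ := hex
    obtain ⟨x, hx, w, hw, hxw₁⟩ := hS₁.exists_boundary hAne hcard
    have hadj : ∀ S, IsExploredBy G ℓ v A S₀ S → S.Adj x w := fun S hS =>
      (hS.agree x hx w).2 ((hS₁.agree x hx w).1 hxw₁)
    have hA' := connected_induce_insert hA hx (hS₁.le hxw₁)
    have hk' : Fintype.card V - (insert w A).card < k := by
      have := Finset.card_lt_univ_of_notMem hw
      rw [Finset.card_insert_of_notMem hw]; omega
    -- passing to `insert w A` once the edges at `w` are known
    have hnext : ∀ S S', IsExploredBy G ℓ v A S₀ S → IsExploredBy G ℓ v A S₀ S' →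
        S.neighborSet w = S'.neighborSet w → IsExploredBy G ℓ v (insert w A) S' S := by
      intro S S' hS hS' heq
      refine ⟨hS.le, hS.even, ?_, ?_, hS.large⟩
      · intro a ha y
        rcases Finset.mem_insert.1 ha with rfl | ha
        · exact Set.ext_iff.1 heq y
        · exact (hS.agree a ha y).trans (hS'.agree a ha y).symm
      · intro a ha
        rcases Finset.mem_insert.1 ha with rfl | ha
        · exact (hS.reachable x hx).trans (hadj S hS).reachable
        · exact hS.reachable a ha
    by_cases hbr : 2 < G.degree w
    · have hbA : (branchVertices G (insert w A)).card = (branchVertices G A).card + 1 := by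
        rw [branchVertices, Finset.filter_insert, if_pos hbr, Finset.card_insert_of_notMem]
        · rfl
        · exact fun h => hw (Finset.mem_filter.1 h).1
      have hfam : ∀ N : Finset V, ∃ 𝓕 : Finset (Finset V),
          𝓕.card ≤ (2 ^ Δ) ^ (J - (branchVertices G A).card - 1) ∧
          (∀ F ∈ 𝓕, IsCertificate G ℓ J F) ∧
          ∀ S, IsExploredBy G ℓ v A S₀ S → S.neighborSet w = N →
            ∃ F ∈ 𝓕, ∀ y ∈ F, S.Reachable v y := by
        intro N
        by_cases hN : ∃ S', IsExploredBy G ℓ v A S₀ S' ∧ S'.neighborSet w = N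
        · obtain ⟨S', hS', hN'⟩ := hN
          obtain ⟨𝓕, h1, h2, h3⟩ := ih (insert w A) S' hk' hA'
          rw [hbA, ← Nat.sub_sub] at h1
          exact ⟨𝓕, h1, h2, fun S hS hSN => h3 S (hnext S S' hS hS' (hSN.trans hN'.symm))⟩
        · exact ⟨∅, by simp, by simp, fun S hS hSN => absurd ⟨S, hS, hSN⟩ hN⟩
      choose 𝓕 h1 h2 h3 using hfam
      refine ⟨(G.neighborFinset w).powerset.biUnion 𝓕, ?_, ?_, ?_⟩
      · refine (Finset.card_biUnion_le_card_mul _ _ _ fun N _ => h1 N).trans ?_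
        rw [Finset.card_powerset, SimpleGraph.card_neighborFinset_eq_degree]
        calc 2 ^ G.degree w * (2 ^ Δ) ^ (J - (branchVertices G A).card - 1)
            ≤ 2 ^ Δ * (2 ^ Δ) ^ (J - (branchVertices G A).card - 1) := by
              gcongr
              · norm_num
              · exact hΔ w
          _ = (2 ^ Δ) ^ (J - (branchVertices G A).card) := by
              rw [← pow_succ']
              congr 1
              omega
      · intro F hF
        obtain ⟨N, _, hN⟩ := Finset.mem_biUnion.1 hF
        exact h2 N F hN
      · intro S hS
        have hN : S.neighborSet w =
            ((G.neighborFinset w).filter fun y => S.Adj w y : Finset V) := by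
          ext y
          simp only [SimpleGraph.mem_neighborSet, Finset.coe_filter,
            SimpleGraph.mem_neighborFinset, Set.mem_ofPred_eq]
          exact ⟨fun h => ⟨hS.le h, h⟩, fun h => h.2⟩
        obtain ⟨F, hF, h⟩ := h3 _ S hS hN
        exact ⟨F, Finset.mem_biUnion.2 ⟨_, by simp, hF⟩, h⟩
    · have hbA : (branchVertices G (insert w A)).card = (branchVertices G A).card := by
        rw [branchVertices, Finset.filter_insert, if_neg hbr]; rfl
      obtain ⟨𝓕, h1, h2, h3⟩ := ih (insert w A) S₁ hk' hA'
      rw [hbA] at h1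
      refine ⟨𝓕, h1, h2, fun S hS => h3 S (hnext S S₁ hS hS₁ ?_)⟩
      ext y
      exact (hS.adj_iff_of_degree_le_two (not_lt.1 hbr) (hadj S hS) y).trans
        (hS₁.adj_iff_of_degree_le_two (not_lt.1 hbr) hxw₁ y).symm

/-- Few certificates suffice for all even subgraphs that contain the star of `v` and whose component
of `v` is large. -/
lemma exists_certificates {Δ : ℕ} {ℓ : ℝ} (hΔ : ∀ x, G.degree x ≤ Δ) (J : ℕ) (v : V) :
    ∃ 𝓕 : Finset (Finset V), 𝓕.card ≤ (2 ^ Δ) ^ J ∧ (∀ F ∈ 𝓕, IsCertificate G ℓ J F) ∧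
      ∀ S ≤ G, (∀ x, Even (S.neighborSet x).ncard) → (∀ y, G.Adj v y → S.Adj v y) →
        ℓ ≤ ({y | S.Reachable v y}.ncard : ℝ) → ∃ F ∈ 𝓕, ∀ y ∈ F, S.Reachable v y := by
  have hv : (G.induce (({v} : Finset V) : Set V)).Connected := by
    rw [Finset.coe_singleton]
    exact SimpleGraph.Connected.mk SimpleGraph.Preconnected.of_subsingleton
  obtain ⟨𝓕, h1, h2, h3⟩ := exists_certificates_of_explored (ℓ := ℓ) hΔ J v _ {v} G
    (Nat.lt_succ_self _) hv
  refine ⟨𝓕, h1.trans (Nat.pow_le_pow_right (by positivity) (Nat.sub_le _ _)), h2, ?_⟩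
  intro S hS heven hstar hlarge
  refine h3 S ⟨hS, heven, ?_, ?_, hlarge⟩
  · intro a ha y
    rw [Finset.mem_singleton.1 ha]
    exact ⟨fun h => hS h, hstar y⟩
  · intro a ha
    rw [Finset.mem_singleton.1 ha]

end Certificates

/-! ### Trajectories: red and blue transitions -/

section Trajectories

variable {V : Type u} {G : SimpleGraph V}

/-- The graph of the edges not traversed by `x` during its first `t` transitions. -/
def unvisitedGraph (G : SimpleGraph V) (x : ℕ → V) (t : ℕ) : SimpleGraph V where
  Adj a b := G.Adj a b ∧ ¬ ∃ i < t, s(x i, x (i + 1)) = s(a, b)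
  symm := ⟨fun a b h => ⟨h.1.symm, by rw [Sym2.eq_swap]; exact h.2⟩⟩
  loopless := ⟨fun a h => G.loopless.irrefl a h.1⟩

/-- The transition at time `t` is red if it is a step of the random walk, that is, if all edges at
the current vertex have been visited. The other transitions are called blue. -/
def IsRed (G : SimpleGraph V) (x : ℕ → V) (t : ℕ) : Prop := unvisitedNeighbors G x t = ∅

open Classical in
/-- The vertex at which the current blue phase started: the vertex reached by the last red
transition, or the start vertex. -/
noncomputable def phaseRoot (G : SimpleGraph V) (x : ℕ → V) : ℕ → V
  | 0 => x 0
  | t + 1 => if IsRed G x t then x (t + 1) else phaseRoot G x t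

open Classical in
/-- The number of red transitions among the first `t` ones. -/
noncomputable def redCount (G : SimpleGraph V) (x : ℕ → V) : ℕ → ℕ
  | 0 => 0
  | t + 1 => redCount G x t + if IsRed G x t then 1 else 0

/-- The first `t` transitions are possible transitions of an `E`-process. -/
def IsValid (G : SimpleGraph V) (x : ℕ → V) (t : ℕ) : Prop :=
  ∀ i < t, (IsRed G x i → G.Adj (x i) (x (i + 1))) ∧
    (¬ IsRed G x i → x (i + 1) ∈ unvisitedNeighbors G x i)

/-- No red transition among the first `t` transitions starts in `F`. -/
def RedAvoids (G : SimpleGraph V) (F : Finset V) (x : ℕ → V) (t : ℕ) : Prop :=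
  ∀ i < t, IsRed G x i → x i ∉ F

lemma isRed_congr {x y : ℕ → V} {t : ℕ} (h : ∀ i ≤ t, x i = y i) : IsRed G x t ↔ IsRed G y t := by
  have : unvisitedNeighbors G x t = unvisitedNeighbors G y t := by
    ext w
    simp only [unvisitedNeighbors, Set.mem_ofPred_eq, h t le_rfl]
    refine and_congr Iff.rfl (not_congr (exists_congr fun i => and_congr_right fun hi => ?_))
    rw [h i hi.le, h (i + 1) hi]
  rw [IsRed, IsRed, this]

lemma phaseRoot_congr {x y : ℕ → V} {t : ℕ} (h : ∀ i ≤ t, x i = y i) :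
    phaseRoot G x t = phaseRoot G y t := by
  classical
  induction t with
  | zero => exact h 0 le_rfl
  | succ t ih =>
    have h' : ∀ i ≤ t, x i = y i := fun i hi => h i (hi.trans (Nat.le_succ t))
    exact if_congr (isRed_congr h') (h (t + 1) le_rfl) (ih h')

lemma redCount_congr {x y : ℕ → V} {t : ℕ} (h : ∀ i < t, x i = y i) :
    redCount G x t = redCount G y t := by
  classical
  induction t with
  | zero => rfl
  | succ t ih =>
    have h' : ∀ i ≤ t, x i = y i := fun i hi => h i (Nat.lt_succ_of_le hi)
    rw [redCount, redCount, ih fun i hi => h' i hi.le, if_congr (isRed_congr (G := G) h') rfl rfl]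

lemma isValid_congr {x y : ℕ → V} {t : ℕ} (h : ∀ i ≤ t, x i = y i) :
    IsValid G x t ↔ IsValid G y t := by
  refine forall_congr' fun i => forall_congr' fun hi => ?_
  have h' : ∀ j ≤ i, x j = y j := fun j hj => h j (hj.trans hi.le)
  have h2 : unvisitedNeighbors G x i = unvisitedNeighbors G y i := by
    ext w
    simp only [unvisitedNeighbors, Set.mem_ofPred_eq, h' i le_rfl]
    refine and_congr Iff.rfl (not_congr (exists_congr fun j => and_congr_right fun hj => ?_))
    rw [h' j hj.le, h' (j + 1) hj]
  rw [isRed_congr h', h2, h i hi.le, h (i + 1) hi]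

lemma unvisitedGraph_anti (x : ℕ → V) {s t : ℕ} (h : s ≤ t) :
    unvisitedGraph G x t ≤ unvisitedGraph G x s := by
  rintro a b ⟨hab, hn⟩
  exact ⟨hab, fun ⟨i, hi, he⟩ => hn ⟨i, hi.trans_le h, he⟩⟩

lemma unvisitedGraph_succ_adj (x : ℕ → V) (t : ℕ) (a b : V) :
    (unvisitedGraph G x (t + 1)).Adj a b ↔
      (unvisitedGraph G x t).Adj a b ∧ s(x t, x (t + 1)) ≠ s(a, b) := by
  constructor
  · rintro ⟨hab, hn⟩
    exact ⟨⟨hab, fun ⟨i, hi, he⟩ => hn ⟨i, hi.trans (Nat.lt_succ_self t), he⟩⟩,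
      fun he => hn ⟨t, Nat.lt_succ_self t, he⟩⟩
  · rintro ⟨⟨hab, hn⟩, hne⟩
    refine ⟨hab, ?_⟩
    rintro ⟨i, hi, he⟩
    rcases Nat.lt_succ_iff_lt_or_eq.1 hi with hi | rfl
    · exact hn ⟨i, hi, he⟩
    · exact hne he

lemma IsRed.unvisitedGraph_succ {x : ℕ → V} {t : ℕ} (h : IsRed G x t) :
    unvisitedGraph G x (t + 1) = unvisitedGraph G x t := by
  ext a b
  rw [unvisitedGraph_succ_adj, and_iff_left_iff_imp]
  intro hab he
  rw [Sym2.eq_iff] at he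
  have hempty : ∀ w, ¬ (unvisitedGraph G x t).Adj (x t) w := fun w hw =>
    Set.eq_empty_iff_forall_notMem.1 h w hw
  rcases he with ⟨h1, _⟩ | ⟨h1, _⟩
  · exact hempty b (h1 ▸ hab)
  · exact hempty a (h1 ▸ hab.symm)

lemma IsValid.mono {x : ℕ → V} {s t : ℕ} (h : IsValid G x t) (hst : s ≤ t) : IsValid G x s :=
  fun i hi => h i (hi.trans_le hst)

/-- If `v` is good and unvisited, then its component in an even unvisited graph is large. -/
lemma le_ncard_unvisited_component {ℓ : ℝ} {v : V} (hv : IsGoodVertex G ℓ v) {x : ℕ → V} {t : ℕ}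
    (heven : ∀ a, Even ((unvisitedGraph G x t).neighborSet a).ncard)
    (hstar : ∀ y, G.Adj v y → (unvisitedGraph G x t).Adj v y) :
    ℓ ≤ ({y | (unvisitedGraph G x t).Reachable v y}.ncard : ℝ) := by
  let H : G.Subgraph :=
    { verts := {y | (unvisitedGraph G x t).Reachable v y}
      Adj := fun a b => (unvisitedGraph G x t).Reachable v a ∧ (unvisitedGraph G x t).Adj a b
      adj_sub := fun h => h.2.1
      edge_vert := fun h => h.1
      symm := ⟨fun a b h => ⟨h.1.trans h.2.reachable, h.2.symm⟩⟩ }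
  refine hv H ⟨SimpleGraph.Reachable.refl v, fun w hw => ⟨SimpleGraph.Reachable.refl v, hstar w hw⟩,
    fun a ha => ?_⟩
  have : H.neighborSet a = (unvisitedGraph G x t).neighborSet a := by
    ext b
    exact ⟨fun h => h.2, fun h => ⟨ha, h⟩⟩
  rw [this]
  exact heven a

variable [Fintype V]

/-- Removing an edge changes the parity of the degree at its two ends. -/
lemma even_ncard_unvisitedGraph_succ {x : ℕ → V} {t : ℕ}
    (h : (unvisitedGraph G x t).Adj (x t) (x (t + 1))) (a : V) :
    Even ((unvisitedGraph G x (t + 1)).neighborSet a).ncard ↔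
      (Even ((unvisitedGraph G x t).neighborSet a).ncard ↔ ¬ (a = x t ∨ a = x (t + 1))) := by
  have hflip : ∀ c, (unvisitedGraph G x t).Adj a c → (∀ b, s(x t, x (t + 1)) = s(a, b) ↔ b = c) →
      (Even ((unvisitedGraph G x (t + 1)).neighborSet a).ncard ↔
      ¬ Even ((unvisitedGraph G x t).neighborSet a).ncard) := by
    intro c hc hb
    have : (unvisitedGraph G x (t + 1)).neighborSet a =
        (unvisitedGraph G x t).neighborSet a \ {c} := by
      ext b
      simp only [SimpleGraph.mem_neighborSet, unvisitedGraph_succ_adj, Set.mem_sdiff,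
        Set.mem_singleton_iff, ne_eq, hb]
    have h2 := Set.ncard_sdiff_singleton_add_one
      (show c ∈ (unvisitedGraph G x t).neighborSet a from hc) (Set.toFinite _)
    rw [this, ← h2, Nat.even_add_one, not_not]
  by_cases h1 : a = x t
  · subst h1
    have := hflip (x (t + 1)) h (fun b => by
      rw [Sym2.eq_iff]
      constructor
      · rintro (h' | h')
        · exact h'.2.symm
        · exact absurd h'.2.symm h.ne
      · intro h'; exact Or.inl ⟨rfl, h'.symm⟩)
    simp [this]
  · by_cases h2 : a = x (t + 1)
    · subst h2
      have := hflip (x t) h.symm (fun b => by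
        rw [Sym2.eq_iff]
        constructor
        · rintro (h' | h')
          · exact absurd h'.1 h.ne
          · exact h'.1.symm
        · intro h'; exact Or.inr ⟨h'.symm, rfl⟩)
      simp [this]
    · have : (unvisitedGraph G x (t + 1)).neighborSet a =
          (unvisitedGraph G x t).neighborSet a := by
        ext b
        simp only [SimpleGraph.mem_neighborSet, unvisitedGraph_succ_adj, and_iff_left_iff_imp]
        intro _ he
        rw [Sym2.eq_iff] at he
        rcases he with h' | h'
        · exact h1 h'.1.symm
        · exact h2 h'.2.symm
      rw [this]
      simp [h1, h2]

/-- The parity invariant: the degree of `a` in the unvisited graph is odd exactly if `a` is one of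
the current vertex and the root of the current blue phase, and these differ. -/
lemma IsValid.even_iff [DecidableRel G.Adj] (hG : ∀ v, Even (G.degree v)) {x : ℕ → V}
    {t : ℕ} (h : IsValid G x t) (a : V) :
    Even ((unvisitedGraph G x t).neighborSet a).ncard ↔ (a = x t ↔ a = phaseRoot G x t) := by
  induction t generalizing a with
  | zero =>
    have : (unvisitedGraph G x 0).neighborSet a = (G.neighborFinset a : Set V) := by
      ext b; simp [unvisitedGraph]
    rw [this, Set.ncard_coe_finset, SimpleGraph.card_neighborFinset_eq_degree]
    simp [hG a, phaseRoot]
  | succ t ih =>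
    have ih' := ih (h.mono (Nat.le_succ t))
    by_cases hr : IsRed G x t
    · have h1 : x t = phaseRoot G x t := by
        have h2 := ih' (x t)
        have h3 : (unvisitedGraph G x t).neighborSet (x t) = ∅ := hr
        rw [h3] at h2
        simpa using h2
      rw [hr.unvisitedGraph_succ, ih' a, phaseRoot, if_pos hr, h1]
      simp
    · have hb : (unvisitedGraph G x t).Adj (x t) (x (t + 1)) :=
        (h t (Nat.lt_succ_self t)).2 hr
      rw [even_ncard_unvisitedGraph_succ hb, ih' a, phaseRoot, if_neg hr]
      by_cases h1 : a = x t
      · have h2 : a ≠ x (t + 1) := h1 ▸ hb.ne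
        simp only [h1, hb.ne]
        tauto
      · simp only [h1]
        tauto

/-- At a red time the current blue phase is over. -/
lemma IsValid.eq_phaseRoot [DecidableRel G.Adj] (hG : ∀ v, Even (G.degree v)) {x : ℕ → V}
    {t : ℕ} (h : IsValid G x t) (hr : IsRed G x t) : x t = phaseRoot G x t := by
  have h2 := h.even_iff hG (x t)
  have h3 : (unvisitedGraph G x t).neighborSet (x t) = ∅ := hr
  rw [h3] at h2
  simpa using h2

/-- Every edge is used by at most one blue transition. -/
lemma IsValid.le_redCount_add {x : ℕ → V} {t : ℕ} (h : IsValid G x t) :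
    (unvisitedGraph G x t).edgeSet.ncard + t ≤ redCount G x t + G.edgeSet.ncard := by
  induction t with
  | zero =>
    simp only [redCount, zero_add, add_zero]
    exact Set.ncard_le_ncard (SimpleGraph.edgeSet_mono fun a b hab => hab.1) (Set.toFinite _)
  | succ t ih =>
    have ih' := ih (h.mono (Nat.le_succ t))
    by_cases hr : IsRed G x t
    · rw [hr.unvisitedGraph_succ, redCount, if_pos hr]
      omega
    · have hb : (unvisitedGraph G x t).Adj (x t) (x (t + 1)) :=
        (h t (Nat.lt_succ_self t)).2 hr
      have h1 : (unvisitedGraph G x (t + 1)).edgeSet ⊆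
          (unvisitedGraph G x t).edgeSet \ {s(x t, x (t + 1))} := by
        intro e
        induction e with
        | h a b =>
          intro he
          rw [SimpleGraph.mem_edgeSet, unvisitedGraph_succ_adj] at he
          exact ⟨he.1, fun h => he.2 (Set.mem_singleton_iff.1 h).symm⟩
      have h2 := Set.ncard_le_ncard h1 (Set.toFinite _)
      have h3 := Set.ncard_sdiff_singleton_add_one
        (show s(x t, x (t + 1)) ∈ (unvisitedGraph G x t).edgeSet from hb) (Set.toFinite _)
      rw [redCount, if_neg hr]
      omega

/-- The unvisited graph is even at the last red time, or at time zero if there was none. -/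
lemma IsValid.exists_even_time [DecidableRel G.Adj] (hG : ∀ v, Even (G.degree v)) {x : ℕ → V}
    {t : ℕ} (h : IsValid G x t) :
    ∃ s ≤ t, (∀ a, Even ((unvisitedGraph G x s).neighborSet a).ncard) ∧
      ∀ i < t, IsRed G x i → i ≤ s := by
  induction t with
  | zero =>
    refine ⟨0, le_rfl, fun a => ?_, fun i hi => absurd hi (Nat.not_lt_zero i)⟩
    rw [h.even_iff hG]; rfl
  | succ t ih =>
    by_cases hr : IsRed G x t
    · refine ⟨t, Nat.le_succ t, fun a => ?_, fun i hi _ => Nat.lt_succ_iff.1 hi⟩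
      rw [(h.mono (Nat.le_succ t)).even_iff hG, ← (h.mono (Nat.le_succ t)).eq_phaseRoot hG hr]
    · obtain ⟨s, hs, h1, h2⟩ := ih (h.mono (Nat.le_succ t))
      refine ⟨s, hs.trans (Nat.le_succ t), h1, fun i hi hri => ?_⟩
      rcases Nat.lt_succ_iff_lt_or_eq.1 hi with hi | rfl
      · exact h2 i hi hri
      · exact absurd hri hr

/-- If `v` is unvisited at time `t`, then one of its certificates has been avoided by all red
transitions. -/
lemma exists_redAvoids_of_unvisited [DecidableRel G.Adj] {Δ : ℕ} {ℓ : ℝ}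
    (hG : IsGoodEvenGraph G Δ ℓ) {v : V} {𝓕 : Finset (Finset V)}
    (h𝓕 : ∀ S ≤ G, (∀ x, Even (S.neighborSet x).ncard) → (∀ y, G.Adj v y → S.Adj v y) →
        ℓ ≤ ({y | S.Reachable v y}.ncard : ℝ) → ∃ F ∈ 𝓕, ∀ y ∈ F, S.Reachable v y)
    {x : ℕ → V} {t : ℕ} (h : IsValid G x t) (hv : ∀ i ≤ t, x i ≠ v) :
    ∃ F ∈ 𝓕, RedAvoids G F x t := by
  obtain ⟨s, hs, heven, hlast⟩ := h.exists_even_time hG.even_degree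
  have hstar : ∀ y, G.Adj v y → (unvisitedGraph G x s).Adj v y := by
    intro y hy
    refine ⟨hy, ?_⟩
    rintro ⟨i, hi, he⟩
    rw [Sym2.eq_iff] at he
    rcases he with ⟨h1, _⟩ | ⟨_, h1⟩
    · exact hv i (by omega) h1
    · exact hv (i + 1) (by omega) h1
  obtain ⟨F, hF, hFr⟩ := h𝓕 (unvisitedGraph G x s) (fun a b hab => hab.1) heven hstar
    (le_ncard_unvisited_component (hG.good v) heven hstar)
  refine ⟨F, hF, fun i hi hr hiF => ?_⟩
  -- a vertex left by a red transition has no unvisited edges, now or later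
  obtain ⟨p⟩ := (hFr _ hiF).symm
  cases p with
  | nil => exact hv i hi.le rfl
  | cons hadj _ =>
    exact Set.eq_empty_iff_forall_notMem.1 hr _ (unvisitedGraph_anti x (hlast i hi hr) hadj)

end Trajectories

/-! ### The embedded random walk -/

section EmbeddedWalk

variable {V : Type u} {Ω : Type v} [Fintype V] [MeasurableSpace Ω] {G : SimpleGraph V}
  [DecidableRel G.Adj] {μ : Measure Ω} {X : ℕ → Ω → V} {u : V}

lemma IsEProcess.measurableSet_cylinder (hX : IsEProcess G μ X u) (x : ℕ → V) (t : ℕ) :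
    MeasurableSet {ω | ∀ i ≤ t, X i ω = x i} := by
  have : {ω | ∀ i ≤ t, X i ω = x i} = ⋂ i, ⋂ (_ : i ≤ t), {ω | X i ω = x i} := by
    ext ω; simp
  rw [this]
  exact MeasurableSet.iInter fun i => MeasurableSet.iInter fun _ => hX.measurable i _

lemma IsEProcess.sum_measureReal_succ [IsProbabilityMeasure μ] (hX : IsEProcess G μ X u) (x : ℕ → V)
    (t : ℕ) :
    ∑ w, μ.real {ω | (∀ i ≤ t, X i ω = x i) ∧ X (t + 1) ω = w} =
      μ.real {ω | ∀ i ≤ t, X i ω = x i} := by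
  rw [← measureReal_biUnion_finset]
  · congr 1
    ext ω; simp
  · intro w _ w' _ hww'
    rw [Function.onFun, Set.disjoint_left]
    rintro ω ⟨_, h1⟩ ⟨_, h2⟩
    exact hww' (h1.symm.trans h2)
  · intro w _
    exact (hX.measurableSet_cylinder x t).inter (hX.measurable (t + 1) w)

lemma IsEProcess.measureReal_red [IsProbabilityMeasure μ] (hX : IsEProcess G μ X u) {x : ℕ → V}
    {t : ℕ} (hr : IsRed G x t) {w : V} (hw : G.Adj (x t) w) :
    μ.real {ω | (∀ i ≤ t, X i ω = x i) ∧ X (t + 1) ω = w} =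
      μ.real {ω | ∀ i ≤ t, X i ω = x i} / G.degree (x t) := by
  rw [Measure.real, hX.random_step t x hr w hw, ENNReal.toReal_div]
  simp [Measure.real]

lemma IsEProcess.measureReal_red_eq_zero [IsProbabilityMeasure μ] (hX : IsEProcess G μ X u)
    (hdeg : ∀ x, 0 < G.degree x) {x : ℕ → V}
    {t : ℕ} (hr : IsRed G x t) {w : V} (hw : ¬ G.Adj (x t) w) :
    μ.real {ω | (∀ i ≤ t, X i ω = x i) ∧ X (t + 1) ω = w} = 0 := by
  classical
  have h1 := hX.sum_measureReal_succ x t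
  rw [← Finset.sum_sdiff (Finset.subset_univ (G.neighborFinset (x t)))] at h1
  have h2 : ∑ w ∈ G.neighborFinset (x t), μ.real {ω | (∀ i ≤ t, X i ω = x i) ∧ X (t + 1) ω = w} =
      μ.real {ω | ∀ i ≤ t, X i ω = x i} := by
    rw [Finset.sum_congr rfl fun w hw => hX.measureReal_red hr (by simpa using hw)]
    have : (0 : ℝ) < G.degree (x t) := by exact_mod_cast hdeg (x t)
    rw [Finset.sum_const, SimpleGraph.card_neighborFinset_eq_degree, nsmul_eq_mul]
    field_simp
  have h3 : ∑ w ∈ Finset.univ \ G.neighborFinset (x t),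
      μ.real {ω | (∀ i ≤ t, X i ω = x i) ∧ X (t + 1) ω = w} = 0 := by linarith
  exact (Finset.sum_eq_zero_iff_of_nonneg fun _ _ => measureReal_nonneg).1 h3 w (by simpa using hw)

lemma IsEProcess.ae_isValid [IsProbabilityMeasure μ] (hX : IsEProcess G μ X u)
    (hdeg : ∀ x, 0 < G.degree x) (t : ℕ) : ∀ᵐ ω ∂μ, IsValid G (fun i => X i ω) t := by
  have hred : ∀ t, ∀ᵐ ω ∂μ, IsRed G (fun i => X i ω) t → G.Adj (X t ω) (X (t + 1) ω) := by
    intro t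
    -- the exceptional set is covered by finitely many null cylinders
    let ext : (Fin (t + 1) → V) → ℕ → V := fun p i => p ⟨min i t, by omega⟩
    let N : (Fin (t + 1) → V) → V → Set Ω := fun p w =>
      {ω | (IsRed G (ext p) t ∧ ¬ G.Adj (ext p t) w) ∧
        ((∀ i ≤ t, X i ω = ext p i) ∧ X (t + 1) ω = w)}
    have hN : ∀ p w, μ (N p w) = 0 := by
      intro p w
      by_cases h : IsRed G (ext p) t ∧ ¬ G.Adj (ext p t) w
      · have h1 := hX.measureReal_red_eq_zero hdeg h.1 h.2
        rw [measureReal_eq_zero_iff] at h1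
        exact measure_mono_null (fun ω hω => hω.2) h1
      · have : N p w = ∅ := by
          ext ω
          simp only [N, Set.mem_ofPred_eq, Set.mem_empty_iff_false, iff_false]
          exact fun hω => h hω.1
        rw [this, measure_empty]
    have hcov : {ω | ¬ (IsRed G (fun i => X i ω) t → G.Adj (X t ω) (X (t + 1) ω))} ⊆
        ⋃ p, ⋃ w, N p w := by
      intro ω hω
      simp only [Set.mem_ofPred_eq, Classical.not_imp] at hω
      simp only [Set.mem_iUnion]
      refine ⟨fun i => X i ω, X (t + 1) ω, ?_⟩
      have hext : ∀ i ≤ t, X i ω = ext (fun i => X i ω) i := by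
        intro i hi
        simp [ext, min_eq_left hi]
      refine ⟨⟨(isRed_congr hext).1 hω.1, ?_⟩, hext, rfl⟩
      rw [← hext t le_rfl]
      exact hω.2
    exact measure_mono_null hcov (measure_iUnion_null fun p => measure_iUnion_null fun w => hN p w)
  have h1 : ∀ᵐ ω ∂μ, ∀ t, IsRed G (fun i => X i ω) t → G.Adj (X t ω) (X (t + 1) ω) :=
    ae_all_iff.2 hred
  have h2 : ∀ᵐ ω ∂μ, ∀ t, (unvisitedNeighbors G (fun i => X i ω) t).Nonempty →
      X (t + 1) ω ∈ unvisitedNeighbors G (fun i => X i ω) t := ae_all_iff.2 hX.unvisited_step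
  filter_upwards [h1, h2] with ω h1 h2 i _
  exact ⟨h1 i, fun h => h2 i (Set.nonempty_iff_ne_empty.2 h)⟩

lemma IsEProcess.isValid_of_ne_zero [IsProbabilityMeasure μ] (hX : IsEProcess G μ X u)
    (hdeg : ∀ x, 0 < G.degree x) {x : ℕ → V} {t : ℕ}
    (h : μ.real {ω | ∀ i ≤ t, X i ω = x i} ≠ 0) : IsValid G x t := by
  by_contra hcon
  apply h
  rw [measureReal_eq_zero_iff]
  refine measure_mono_null ?_ (hX.ae_isValid hdeg t)
  intro ω hω
  simp only [Set.mem_ofPred_eq] at hω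
  exact fun hval => hcon ((isValid_congr hω).1 hval)

variable [DecidableEq V]

/-- The red transitions form a simple random walk: the probability that they avoid `F`, given the
first `k` transitions, is bounded by the corresponding probability for the remaining red steps.
The blue transitions only delay the walk, by at most `|E|` steps in total. -/
lemma IsEProcess.measureReal_redAvoids_inter_le [IsProbabilityMeasure μ] (hX : IsEProcess G μ X u)
    (hG : ∀ v, Even (G.degree v)) (hdeg : ∀ x, 0 < G.degree x) (F : Finset V) (T : ℕ) :
    ∀ (s k : ℕ) (x : ℕ → V), k + s = T + G.edgeSet.ncard →
      μ.real {ω | (∀ i ≤ k, X i ω = x i) ∧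
        RedAvoids G F (fun i => X i ω) (T + G.edgeSet.ncard)} ≤
      μ.real {ω | ∀ i ≤ k, X i ω = x i} *
        survival G F (T - redCount G x k) (phaseRoot G x k) := by
  intro s
  induction s with
  | zero =>
    intro k x hk
    by_cases h0 : μ.real {ω | ∀ i ≤ k, X i ω = x i} = 0
    · rw [h0, zero_mul, ← h0]
      exact measureReal_mono fun ω hω => hω.1
    have hval := hX.isValid_of_ne_zero hdeg h0
    have h1 := hval.le_redCount_add
    have h2 : T - redCount G x k = 0 := by omega
    rw [h2, survival, mul_one]
    exact measureReal_mono fun ω hω => hω.1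
  | succ s ih =>
    intro k x hk
    by_cases h0 : μ.real {ω | ∀ i ≤ k, X i ω = x i} = 0
    · rw [h0, zero_mul, ← h0]
      exact measureReal_mono fun ω hω => hω.1
    have hval := hX.isValid_of_ne_zero hdeg h0
    let y : V → ℕ → V := fun w => Function.update x (k + 1) w
    have hy : ∀ w, ∀ i ≤ k, y w i = x i := fun w i hi =>
      Function.update_of_ne (by omega) _ _
    have hyk : ∀ w, y w (k + 1) = w := fun w => Function.update_self _ _ _
    have hcyl : ∀ w ω, (∀ i ≤ k + 1, X i ω = y w i) ↔ (∀ i ≤ k, X i ω = x i) ∧ X (k + 1) ω = w := by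
      intro w ω
      constructor
      · intro h
        exact ⟨fun i hi => (h i (by omega)).trans (hy w i hi), (h (k + 1) le_rfl).trans (hyk w)⟩
      · rintro ⟨h1, h2⟩ i hi
        rcases Nat.le_succ_iff.1 hi with hi | rfl
        · exact (h1 i hi).trans (hy w i hi).symm
        · exact h2.trans (hyk w).symm
    have hsplit : μ.real {ω | (∀ i ≤ k, X i ω = x i) ∧
          RedAvoids G F (fun i => X i ω) (T + G.edgeSet.ncard)} ≤
        ∑ w, μ.real {ω | (∀ i ≤ k, X i ω = x i) ∧ X (k + 1) ω = w} *
          survival G F (T - redCount G (y w) (k + 1)) (phaseRoot G (y w) (k + 1)) := by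
      calc _ ≤ μ.real (⋃ w ∈ Finset.univ, {ω | (∀ i ≤ k + 1, X i ω = y w i) ∧
              RedAvoids G F (fun i => X i ω) (T + G.edgeSet.ncard)}) := by
            refine measureReal_mono (fun ω hω => ?_) (measure_ne_top _ _)
            simp only [Finset.mem_univ, Set.iUnion_true, Set.mem_iUnion]
            exact ⟨X (k + 1) ω, (hcyl _ _).2 ⟨hω.1, rfl⟩, hω.2⟩
        _ ≤ ∑ w, μ.real {ω | (∀ i ≤ k + 1, X i ω = y w i) ∧
              RedAvoids G F (fun i => X i ω) (T + G.edgeSet.ncard)} :=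
            measureReal_biUnion_finset_le _ _
        _ ≤ _ := by
            refine Finset.sum_le_sum fun w _ => ?_
            have := ih (k + 1) (y w) (by omega)
            simpa only [hcyl w] using this
    have hrc : ∀ w, redCount G (y w) k = redCount G x k := fun w =>
      redCount_congr fun i hi => hy w i hi.le
    by_cases hr : IsRed G x k
    · have hr' : ∀ w, IsRed G (y w) k := fun w => (isRed_congr (hy w)).2 hr
      have h1 : ∀ w, redCount G (y w) (k + 1) = redCount G x k + 1 := fun w => by
        rw [redCount, if_pos (hr' w), hrc]
      have h2 : ∀ w, phaseRoot G (y w) (k + 1) = w := fun w => by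
        rw [phaseRoot, if_pos (hr' w), hyk]
      simp only [h1, h2] at hsplit
      rw [← hval.eq_phaseRoot hG hr]
      rcases Nat.lt_or_ge (redCount G x k) T with hT | hT
      · obtain ⟨m, hm⟩ : ∃ m, T - redCount G x k = m + 1 := ⟨T - redCount G x k - 1, by omega⟩
        have hm' : T - (redCount G x k + 1) = m := by omega
        rw [hm'] at hsplit
        rw [hm, survival]
        by_cases hF : x k ∈ F
        · rw [if_pos hF, mul_zero]
          have : {ω | (∀ i ≤ k, X i ω = x i) ∧
              RedAvoids G F (fun i => X i ω) (T + G.edgeSet.ncard)} = ∅ := by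
            ext ω
            simp only [Set.mem_ofPred_eq, Set.mem_empty_iff_false, iff_false]
            rintro ⟨h3, h4⟩
            refine h4 k (by omega) ((isRed_congr h3).2 hr) ?_
            simp only [h3 k le_rfl]
            exact hF
          rw [this]
          simp
        · rw [if_neg hF]
          refine hsplit.trans (le_of_eq ?_)
          rw [← Finset.sum_subset (Finset.subset_univ (G.neighborFinset (x k)))]
          · rw [Finset.mul_sum, Finset.mul_sum]
            refine Finset.sum_congr rfl fun w hw => ?_
            rw [hX.measureReal_red hr (by simpa using hw)]
            ring
          · intro w _ hw
            rw [hX.measureReal_red_eq_zero hdeg hr (by simpa using hw), zero_mul]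
      · have h3 : T - (redCount G x k + 1) = 0 := by omega
        have h4 : T - redCount G x k = 0 := by omega
        rw [h3] at hsplit
        rw [h4]
        simp only [survival, mul_one] at hsplit ⊢
        exact hsplit.trans (le_of_eq (hX.sum_measureReal_succ x k))
    · have hr' : ∀ w, ¬ IsRed G (y w) k := fun w => fun h => hr ((isRed_congr (hy w)).1 h)
      have h1 : ∀ w, redCount G (y w) (k + 1) = redCount G x k := fun w => by
        rw [redCount, if_neg (hr' w), hrc, add_zero]
      have h2 : ∀ w, phaseRoot G (y w) (k + 1) = phaseRoot G x k := fun w => by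
        rw [phaseRoot, if_neg (hr' w), phaseRoot_congr (hy w)]
      simp only [h1, h2] at hsplit
      rwa [← Finset.sum_mul, hX.sum_measureReal_succ x k] at hsplit

lemma IsEProcess.measureReal_redAvoids_le [IsProbabilityMeasure μ] (hX : IsEProcess G μ X u)
    (hG : ∀ v, Even (G.degree v)) (hdeg : ∀ x, 0 < G.degree x) (F : Finset V) (T : ℕ) :
    μ.real {ω | RedAvoids G F (fun i => X i ω) (T + G.edgeSet.ncard)} ≤ survival G F T u := by
  have h1 := hX.measureReal_redAvoids_inter_le hG hdeg F T (T + G.edgeSet.ncard) 0 (fun _ => u)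
    (by omega)
  simp only [redCount, phaseRoot, Nat.sub_zero] at h1
  calc μ.real {ω | RedAvoids G F (fun i => X i ω) (T + G.edgeSet.ncard)}
      = μ.real {ω | (∀ i ≤ 0, X i ω = u) ∧
          RedAvoids G F (fun i => X i ω) (T + G.edgeSet.ncard)} := by
        apply measureReal_congr
        filter_upwards [hX.start] with ω hω
        apply propext
        refine ⟨fun h => ⟨fun i hi => ?_, h⟩, fun h => h.2⟩
        rw [Nat.le_zero.1 hi, hω]
    _ ≤ _ := h1
    _ ≤ 1 * survival G F T u :=
        mul_le_mul_of_nonneg_right measureReal_le_one (survival_nonneg F T u)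
    _ = _ := one_mul _

end EmbeddedWalk

/-! ### Expected cover times -/

section CoverTime

/-- The cover step is at most the number of times at which some vertex is still unvisited. -/
lemma coverStep_le_tsum {V : Type*} (x : ℕ → V) :
    coverStep x ≤ ∑' k : ℕ,
      {y : ℕ → V | ∃ v, ∀ i ≤ k, y i ≠ v}.indicator (1 : (ℕ → V) → ℝ≥0∞) x := by
  classical
  by_cases h : ∃ k, ∀ v, ∃ i ≤ k, x i = v
  · calc coverStep x ≤ (Nat.find h : ℝ≥0∞) := iInf₂_le (Nat.find h) (Nat.find_spec h)
      _ = ∑ k ∈ Finset.range (Nat.find h), (1 : ℝ≥0∞) := by simp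
      _ ≤ ∑ k ∈ Finset.range (Nat.find h),
          {y : ℕ → V | ∃ v, ∀ i ≤ k, y i ≠ v}.indicator (1 : (ℕ → V) → ℝ≥0∞) x := by
        refine Finset.sum_le_sum fun k hk => ?_
        have := Nat.find_min h (Finset.mem_range.1 hk)
        push Not at this
        rw [Set.indicator_of_mem]
        · simp
        · exact this
      _ ≤ _ := ENNReal.sum_le_tsum _
  · push Not at h
    have : ∀ k : ℕ, {y : ℕ → V | ∃ v, ∀ i ≤ k, y i ≠ v}.indicator (1 : (ℕ → V) → ℝ≥0∞) x = 1 :=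
      fun k => Set.indicator_of_mem (s := {y : ℕ → V | ∃ v, ∀ i ≤ k, y i ≠ v}) (h k) _
    simp [this]

lemma card_le_coverStep_add_one {V : Type*} [Fintype V] (x : ℕ → V) :
    (Fintype.card V : ℝ≥0∞) ≤ coverStep x + 1 := by
  classical
  have h : ((Fintype.card V - 1 : ℕ) : ℝ≥0∞) ≤ coverStep x := by
    refine le_iInf₂ fun t ht => ?_
    have h1 : Fintype.card V ≤ t + 1 := by
      rw [← Finset.card_univ, ← Finset.card_range (t + 1)]
      refine Finset.card_le_card_of_surjOn x ?_
      intro v _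
      obtain ⟨i, hi, rfl⟩ := ht v
      exact ⟨i, by simpa using Nat.lt_succ_of_le hi, rfl⟩
    exact_mod_cast (by omega : Fintype.card V - 1 ≤ t)
  calc (Fintype.card V : ℝ≥0∞) ≤ ((Fintype.card V - 1 : ℕ) : ℝ≥0∞) + 1 := by
        exact_mod_cast (by omega : Fintype.card V ≤ Fintype.card V - 1 + 1)
    _ ≤ coverStep x + 1 := by gcongr

lemma card_le_vertexCoverTime_add_one {V : Type u} {Ω : Type v} [Fintype V] [Nonempty V]
    [MeasurableSpace Ω] (μ : V → Measure Ω) [∀ x, IsProbabilityMeasure (μ x)] (X : V → ℕ → Ω → V) :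
    (Fintype.card V : ℝ≥0∞) ≤ vertexCoverTime μ X + 1 := by
  obtain ⟨v⟩ := ‹Nonempty V›
  have h1 : ((Fintype.card V : ℝ≥0∞) - 1) ≤ ∫⁻ ω, coverStep (fun t => X v t ω) ∂(μ v) := by
    calc ((Fintype.card V : ℝ≥0∞) - 1) = ∫⁻ _ω, ((Fintype.card V : ℝ≥0∞) - 1) ∂(μ v) := by simp
      _ ≤ _ := lintegral_mono fun ω => tsub_le_iff_right.2 (card_le_coverStep_add_one _)
  exact tsub_le_iff_right.1
    (h1.trans (le_iSup (fun v => ∫⁻ ω, coverStep (fun t => X v t ω) ∂(μ v)) v))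

variable {V : Type u} {Ω : Type v} [Fintype V] [MeasurableSpace Ω] {G : SimpleGraph V}
  [DecidableRel G.Adj] {μ : Measure Ω} {X : ℕ → Ω → V} {u : V}

lemma IsEProcess.lintegral_coverStep_le (hX : IsEProcess G μ X u) :
    ∫⁻ ω, coverStep (fun t => X t ω) ∂μ ≤ ∑' k : ℕ, μ {ω | ∃ v, ∀ i ≤ k, X i ω ≠ v} := by
  have hmeas : ∀ k : ℕ, MeasurableSet {ω | ∃ v, ∀ i ≤ k, X i ω ≠ v} := by
    intro k
    have : {ω | ∃ v, ∀ i ≤ k, X i ω ≠ v} = ⋃ v, ⋂ i, ⋂ (_ : i ≤ k), {ω | X i ω = v}ᶜ := by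
      ext ω; simp
    rw [this]
    exact MeasurableSet.iUnion fun v => MeasurableSet.iInter fun i => MeasurableSet.iInter fun _ =>
      (hX.measurable i v).compl
  calc ∫⁻ ω, coverStep (fun t => X t ω) ∂μ
      ≤ ∫⁻ ω, ∑' k : ℕ, {ω | ∃ v, ∀ i ≤ k, X i ω ≠ v}.indicator (1 : Ω → ℝ≥0∞) ω ∂μ :=
        lintegral_mono fun ω => coverStep_le_tsum fun t => X t ω
    _ = ∑' k : ℕ, ∫⁻ ω, {ω | ∃ v, ∀ i ≤ k, X i ω ≠ v}.indicator (1 : Ω → ℝ≥0∞) ω ∂μ :=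
        lintegral_tsum fun k => (measurable_one.indicator (hmeas k)).aemeasurable
    _ = _ := by
        congr 1; ext k
        rw [lintegral_indicator_one (hmeas k)]

/-- Summing a geometric tail bound which becomes effective after `m + log A / κ` steps. -/
lemma tsum_le_of_geometric_tail {a : ℕ → ℝ≥0∞} {m : ℕ} {A κ : ℝ} (hA : 1 ≤ A) (hκ : 0 < κ)
    (hκ1 : κ ≤ 1) (h1 : ∀ k, a k ≤ 1) (h2 : ∀ t, a (t + m) ≤ ENNReal.ofReal (A * (1 - κ) ^ t)) :
    ∑' k, a k ≤ ENNReal.ofReal (m + 1 + (Real.log A + 1) / κ) := by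
  set t₀ := ⌈Real.log A / κ⌉₊ with ht₀
  have hlog : 0 ≤ Real.log A := Real.log_nonneg hA
  have hA0 : 0 < A := by linarith
  have h3 : A * (1 - κ) ^ t₀ ≤ 1 := by
    have h4 : (1 - κ) ^ t₀ ≤ Real.exp (-κ) ^ t₀ := by
      gcongr
      exact Real.one_sub_le_exp_neg κ
    have h5 : Real.log A ≤ t₀ * κ := by
      rw [← div_le_iff₀ hκ]; exact Nat.le_ceil _
    calc A * (1 - κ) ^ t₀ ≤ A * Real.exp (-κ) ^ t₀ := by gcongr
      _ = Real.exp (Real.log A) * Real.exp (t₀ * -κ) := by rw [Real.exp_log hA0, Real.exp_nat_mul]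
      _ = Real.exp (Real.log A - t₀ * κ) := by rw [← Real.exp_add]; congr 1; ring
      _ ≤ 1 := Real.exp_le_one_iff.2 (by linarith)
  have h4 : (t₀ : ℝ) ≤ Real.log A / κ + 1 := (Nat.ceil_lt_add_one (by positivity)).le
  have hgeo := hasSum_geometric_of_lt_one (r := 1 - κ) (by linarith) (by linarith)
  rw [sub_sub_cancel] at hgeo
  have htail : ∑' k, a (k + (t₀ + m)) ≤ ENNReal.ofReal (1 / κ) := by
    calc ∑' k, a (k + (t₀ + m)) ≤ ∑' k, ENNReal.ofReal ((1 - κ) ^ k) := by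
          refine ENNReal.tsum_le_tsum fun k => ?_
          rw [← add_assoc]
          refine (h2 (k + t₀)).trans (ENNReal.ofReal_le_ofReal ?_)
          calc A * (1 - κ) ^ (k + t₀) = (1 - κ) ^ k * (A * (1 - κ) ^ t₀) := by rw [pow_add]; ring
            _ ≤ (1 - κ) ^ k * 1 := by
              gcongr
            _ = _ := mul_one _
      _ = ENNReal.ofReal (1 / κ) := by
          rw [← ENNReal.ofReal_tsum_of_nonneg (fun k => pow_nonneg (by linarith) k) hgeo.summable,
            hgeo.tsum_eq, one_div]
  have hhead : ∑ k ∈ Finset.range (t₀ + m), a k ≤ ENNReal.ofReal (t₀ + m) := by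
    calc ∑ k ∈ Finset.range (t₀ + m), a k ≤ ∑ k ∈ Finset.range (t₀ + m), 1 :=
          Finset.sum_le_sum fun k _ => h1 k
      _ = ((t₀ + m : ℕ) : ℝ≥0∞) := by simp
      _ = _ := by rw [← ENNReal.ofReal_natCast]; push_cast; rfl
  rw [← Summable.sum_add_tsum_nat_add' (k := t₀ + m) ENNReal.summable]
  refine (add_le_add hhead htail).trans ?_
  rw [← ENNReal.ofReal_add (by positivity) (by positivity)]
  refine ENNReal.ofReal_le_ofReal ?_
  rw [add_div]
  linarith

lemma ncard_edgeSet_le {Δ : ℕ} (hΔ : ∀ x, G.degree x ≤ Δ) :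
    G.edgeSet.ncard ≤ Fintype.card V * Δ := by
  have h1 := G.sum_degrees_eq_twice_card_edges
  have h2 : ∑ v, G.degree v ≤ Fintype.card V * Δ :=
    (Finset.sum_le_card_nsmul _ _ Δ fun x _ => hΔ x).trans (by simp)
  have h3 : G.edgeSet.ncard = G.edgeFinset.card := by
    rw [← SimpleGraph.coe_edgeFinset, Set.ncard_coe_finset]
  omega

variable [DecidableEq V]

/-- A union bound over all vertices and their certificates. The extra `1 + |E|` transitions pay for
the blue ones and for the first red one, as `survival_le` gives no decay for the first step. -/
lemma IsEProcess.measureReal_uncovered_le [IsProbabilityMeasure μ] (hX : IsEProcess G μ X u)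
    {Δ : ℕ} {ℓ : ℝ} (hG : IsGoodEvenGraph G Δ ℓ) (hdeg : ∀ x, 0 < G.degree x) {J : ℕ} {κ : ℝ}
    (hκ1 : κ < 1)
    (hκ : ∀ F, IsCertificate G ℓ J F → ∀ g : V → ℝ, (∀ x ∈ F, g x = 0) →
      κ * degNormSq G g ≤ energy G g) (t : ℕ) :
    μ.real {ω | ∃ v, ∀ i ≤ t + (1 + G.edgeSet.ncard), X i ω ≠ v} ≤
      Fintype.card V * ((2 ^ Δ) ^ J) * degVol G * (1 - κ) ^ t := by
  choose 𝓕 h1 h2 h3 using fun v => exists_certificates (ℓ := ℓ) hG.degree_le J v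
  have hK : t + (1 + G.edgeSet.ncard) = t + 1 + G.edgeSet.ncard := by ring
  rw [hK]
  have hvol0 : 0 ≤ degVol G := Finset.sum_nonneg fun _ _ => Nat.cast_nonneg _
  have hρ : 0 ≤ 1 - κ := by linarith
  calc μ.real {ω | ∃ v, ∀ i ≤ t + 1 + G.edgeSet.ncard, X i ω ≠ v}
      ≤ μ.real (⋃ v ∈ Finset.univ, ⋃ F ∈ 𝓕 v,
          {ω | RedAvoids G F (fun i => X i ω) (t + 1 + G.edgeSet.ncard)}) := by
        refine ENNReal.toReal_mono (measure_ne_top _ _) (measure_mono_ae ?_)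
        filter_upwards [hX.ae_isValid hdeg (t + 1 + G.edgeSet.ncard)] with ω hω hv
        obtain ⟨v, hv⟩ := hv
        obtain ⟨F, hF, hav⟩ := exists_redAvoids_of_unvisited hG (h3 v) hω hv
        apply Set.mem_iUnion₂.2
        refine ⟨v, Finset.mem_univ v, Set.mem_iUnion₂.2 ⟨F, hF, hav⟩⟩
    _ ≤ ∑ v, ∑ F ∈ 𝓕 v, μ.real {ω | RedAvoids G F (fun i => X i ω) (t + 1 + G.edgeSet.ncard)} :=
        (measureReal_biUnion_finset_le _ _).trans
          (Finset.sum_le_sum fun v _ => measureReal_biUnion_finset_le _ _)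
    _ ≤ ∑ v : V, ∑ F ∈ 𝓕 v, degVol G * (1 - κ) ^ t := by
        refine Finset.sum_le_sum fun v _ => Finset.sum_le_sum fun F hF => ?_
        exact (hX.measureReal_redAvoids_le hG.even_degree hdeg F (t + 1)).trans
          (survival_le hκ1 hdeg (hκ F (h2 v F hF)) t u)
    _ ≤ ∑ v : V, ((2 ^ Δ) ^ J) * (degVol G * (1 - κ) ^ t) := by
        refine Finset.sum_le_sum fun v _ => ?_
        rw [Finset.sum_const, nsmul_eq_mul]
        gcongr
        exact_mod_cast h1 v
    _ = _ := by rw [Finset.sum_const, Finset.card_univ, nsmul_eq_mul]; ring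

/-- Certificates are required to have `branchConst Δ * log n` branch vertices. -/
noncomputable def branchConst (Δ : ℕ) : ℝ := (1 + (1 + Δ) ^ 2) * Δ * (40 * Δ ^ 2)

/-- The constant `C(Δ)` of the main bound. -/
noncomputable def coverConst (Δ : ℕ) : ℝ :=
  Δ + 1 + 16 * Δ * (Δ * branchConst Δ + 3 * Δ + 4)

lemma branchConst_nonneg (Δ : ℕ) : 0 ≤ branchConst Δ := by unfold branchConst; positivity

lemma one_le_coverConst (Δ : ℕ) : 1 ≤ coverConst Δ := by
  have := branchConst_nonneg Δ
  unfold coverConst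
  have : 0 ≤ 16 * (Δ : ℝ) * (Δ * branchConst Δ + 3 * Δ + 4) := by positivity
  have : (0 : ℝ) ≤ Δ := Nat.cast_nonneg _
  linarith

/-- With `κ` of order `γℓ/n` and `log A` of order `log n` in the geometric tail, the expected cover
time is of order `n + n log n / (ℓγ)`. -/
lemma IsEProcess.lintegral_coverStep_le_of_gap [IsProbabilityMeasure μ] (hX : IsEProcess G μ X u)
    {Δ : ℕ} {ℓ : ℝ} (hℓ : 0 < ℓ) (hG : IsGoodEvenGraph G Δ ℓ) (hn : 2 ≤ Fintype.card V) {γ : ℝ}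
    (hγ : 0 < γ) (hγ1 : γ ≤ 1) (hP : HasSpectralGap G γ) :
    ∫⁻ ω, coverStep (fun t => X t ω) ∂μ ≤ ENNReal.ofReal (coverConst Δ *
      (Fintype.card V + Fintype.card V * Real.log (Fintype.card V) / (ℓ * γ))) := by
  have hnt : Nontrivial V := Fintype.one_lt_card_iff_nontrivial.1 hn
  have hdeg : ∀ x, 0 < G.degree x := fun x =>
    hG.connected.preconnected.degree_pos_of_nontrivial x
  have hn' : (2 : ℝ) ≤ Fintype.card V := by exact_mod_cast hn
  have hΔ : (1 : ℝ) ≤ Δ := by exact_mod_cast (hdeg u).trans_le (hG.degree_le u)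
  set n : ℝ := (Fintype.card V : ℝ) with hndef
  set L := Real.log n with hL
  have hL1 : 1 ≤ 3 / 2 * L := by
    have h1 : Real.log 2 ≤ L := Real.log_le_log (by norm_num) hn'
    linarith [Real.log_two_gt_d9]
  have hB := branchConst_nonneg Δ
  -- the number `J` of branch vertices of a certificate has to exceed a multiple of `ℓ√γ`, which is
  -- `O(log n)`; so the number of certificates is polynomial in `n`
  set J := ⌈branchConst Δ * L⌉₊ with hJdef
  have hJ : (1 + (1 + (Δ : ℝ)) ^ 2) * Δ * (ℓ * √γ) ≤ J := by
    refine le_trans ?_ (Nat.le_ceil _)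
    rw [branchConst, mul_assoc _ (40 * (Δ : ℝ) ^ 2) L]
    exact mul_le_mul_of_nonneg_left (hG.mul_sqrt_gap_le hn hdeg hγ hγ1 hP) (by positivity)
  have hJ2 : (J : ℝ) ≤ branchConst Δ * L + 1 :=
    (Nat.ceil_lt_add_one (mul_nonneg hB (by linarith))).le
  set κ := γ * ℓ / (16 * (n * Δ)) with hκdef
  have hκ0 : 0 < κ := by positivity
  have hκ1 : κ < 1 := by
    rw [hκdef, div_lt_one (by positivity)]
    have h1 : γ * ℓ ≤ 1 * n := mul_le_mul hγ1 hG.le_card hℓ.le (by norm_num)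
    nlinarith
  set A := n * ((2 ^ Δ) ^ J) * degVol G with hA
  have hvol : 1 ≤ degVol G := by
    have hx : (1 : ℝ) ≤ G.degree u := by exact_mod_cast hdeg u
    exact hx.trans (Finset.single_le_sum (f := fun x => (G.degree x : ℝ))
      (fun x _ => Nat.cast_nonneg _) (Finset.mem_univ u))
  have hA1 : 1 ≤ A := by
    have h1 : (1 : ℝ) ≤ (2 ^ Δ) ^ J := one_le_pow₀ (one_le_pow₀ (by norm_num))
    have h2 : (1 : ℝ) ≤ n * (2 ^ Δ) ^ J := by nlinarith
    rw [hA]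
    nlinarith
  have hlogA : Real.log A + 1 ≤ (Δ * branchConst Δ + 3 * Δ + 4) * L := by
    have h1 : Real.log A = L + J * (Δ * Real.log 2) + Real.log (degVol G) := by
      rw [hA, Real.log_mul (by positivity) (by positivity), Real.log_mul (by positivity)
        (by positivity), Real.log_pow, Real.log_pow]
    have h2 : Real.log (degVol G) ≤ L + Δ := by
      have h3 := Real.log_le_log (by linarith) (degVol_le (G := G) hG.degree_le)
      rw [Real.log_mul (by positivity) (by positivity)] at h3
      have h4 := Real.log_le_sub_one_of_pos (show (0 : ℝ) < Δ by linarith)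
      linarith
    have h3 : Δ * Real.log 2 ≤ Δ * 1 := by
      gcongr
      linarith [Real.log_two_lt_d9]
    have h4 : J * (Δ * Real.log 2) ≤ (branchConst Δ * L + 1) * (Δ * 1) :=
      mul_le_mul hJ2 h3 (by have := Real.log_pos one_lt_two; positivity) (by nlinarith)
    have h5 : (2 * Δ + 1) * 1 ≤ (2 * Δ + 1) * (3 / 2 * L) := by gcongr
    rw [h1]
    nlinarith
  have htail : ∀ t, μ {ω | ∃ v, ∀ i ≤ t + (1 + G.edgeSet.ncard), X i ω ≠ v} ≤
      ENNReal.ofReal (A * (1 - κ) ^ t) := fun t => by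
    rw [← ofReal_measureReal]
    exact ENNReal.ofReal_le_ofReal (hX.measureReal_uncovered_le hG hdeg hκ1
      (fun F hF g hg => hG.dirichlet_ge hℓ hdeg hγ hP hJ hF g hg) t)
  refine (hX.lintegral_coverStep_le.trans (tsum_le_of_geometric_tail hA1 hκ0 hκ1.le
    (fun k => prob_le_one) htail)).trans (ENNReal.ofReal_le_ofReal ?_)
  have hE : (G.edgeSet.ncard : ℝ) ≤ n * Δ := by
    rw [hndef]; exact_mod_cast ncard_edgeSet_le hG.degree_le
  have h1 : (Real.log A + 1) / κ ≤
      16 * Δ * (Δ * branchConst Δ + 3 * Δ + 4) * (n * L / (ℓ * γ)) := by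
    calc (Real.log A + 1) / κ ≤ ((Δ * branchConst Δ + 3 * Δ + 4) * L) / κ := by gcongr
      _ = _ := by rw [hκdef]; field_simp
  have h2 : 0 ≤ n * L / (ℓ * γ) := by
    have : 0 ≤ L := by linarith
    positivity
  have h3 : (0 : ℝ) ≤ (Δ + 1) * (n * L / (ℓ * γ)) := by positivity
  have h4 : (0 : ℝ) ≤ 16 * Δ * (Δ * branchConst Δ + 3 * Δ + 4) * n := by positivity
  have h5 : coverConst Δ * (n + n * L / (ℓ * γ)) = (Δ + 1) * n + (Δ + 1) * (n * L / (ℓ * γ)) +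
      16 * Δ * (Δ * branchConst Δ + 3 * Δ + 4) * n +
      16 * Δ * (Δ * branchConst Δ + 3 * Δ + 4) * (n * L / (ℓ * γ)) := by
    rw [coverConst]; ring
  rw [h5]
  push_cast
  linarith

lemma vertexCoverTime_le {Δ : ℕ} {ℓ : ℝ} {P : Matrix V V ℝ} (μ : V → Measure Ω)
    [∀ x, IsProbabilityMeasure (μ x)] (X : V → ℕ → Ω → V) (hℓ : 0 < ℓ)
    (hG : IsGoodEvenGraph G Δ ℓ) (hP : P = walkMatrix G ∨ P = lazyWalkMatrix G)
    (hX : ∀ x, IsEProcess G (μ x) (X x) x) :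
    vertexCoverTime μ X ≤ (coverConst Δ).toNNReal * ((Fintype.card V : ℝ≥0∞) +
      (Fintype.card V : ℝ≥0∞) * ENNReal.ofReal (Real.log (Fintype.card V)) /
        (ENNReal.ofReal ℓ * ENNReal.ofReal (1 - lambdaMax P))) := by
  have hC := one_le_coverConst Δ
  refine iSup_le fun u => ?_
  rcases Nat.lt_or_ge (Fintype.card V) 2 with hn | hn
  · -- on one vertex, the cover time is zero
    have hsub : Subsingleton V := Fintype.card_le_one_iff_subsingleton.1 (by omega)
    have : ∀ ω, coverStep (fun t => X u t ω) = 0 := fun ω =>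
      le_antisymm ((iInf₂_le 0 fun v => ⟨0, le_rfl, Subsingleton.elim _ _⟩).trans (by simp))
        (zero_le)
    simp [this]
  have hn' : (2 : ℝ) ≤ Fintype.card V := by exact_mod_cast hn
  have hlog : 0 < Real.log (Fintype.card V) := Real.log_pos (by linarith)
  rcases le_or_gt 1 (lambdaMax P) with hle | hlt
  · -- no spectral gap: the right-hand side is infinite
    have h1 : ENNReal.ofReal (1 - lambdaMax P) = 0 := ENNReal.ofReal_eq_zero.2 (by linarith)
    have h2 : (Fintype.card V : ℝ≥0∞) * ENNReal.ofReal (Real.log (Fintype.card V)) ≠ 0 := by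
      refine mul_ne_zero ?_ ?_
      · exact_mod_cast (by omega : Fintype.card V ≠ 0)
      · rw [Ne, ENNReal.ofReal_eq_zero]; linarith
    have h3 : ((coverConst Δ).toNNReal : ℝ≥0∞) ≠ 0 := by
      rw [ENNReal.coe_ne_zero, Ne, Real.toNNReal_eq_zero]; linarith
    rw [h1, mul_zero, ENNReal.div_zero h2, add_top, ENNReal.mul_top h3]
    exact le_top
  have hnt : Nontrivial V := Fintype.one_lt_card_iff_nontrivial.1 hn
  have hdeg : ∀ x, 0 < G.degree x := fun x =>
    hG.connected.preconnected.degree_pos_of_nontrivial x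
  have hγ : 0 < 1 - lambdaMax P := by linarith
  refine ((hX u).lintegral_coverStep_le_of_gap hℓ hG hn hγ
    (by linarith [lambdaMax_nonneg P]) (poincare hG.connected hdeg hP hlt)).trans (le_of_eq ?_)
  rw [ENNReal.ofReal_mul (by linarith), ENNReal.ofReal_add (by positivity) (by positivity),
    ENNReal.ofReal_div_of_pos (by positivity), ENNReal.ofReal_mul (by positivity),
    ENNReal.ofReal_mul hℓ.le, ENNReal.ofReal_natCast]
  rfl

end CoverTime

theorem theorem1 (Δ : ℕ) :
    -- the general bound, with a constant that depends on the maximum degree only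
    (∃ C : ℝ≥0, ∀ (V : Type u) [Fintype V] [DecidableEq V] (G : SimpleGraph V) [DecidableRel G.Adj]
        (ℓ : ℝ) (P : Matrix V V ℝ) (Ω : Type v) [MeasurableSpace Ω]
        (μ : V → Measure Ω) [∀ x, IsProbabilityMeasure (μ x)] (X : V → ℕ → Ω → V),
        0 < ℓ → IsGoodEvenGraph G Δ ℓ → (P = walkMatrix G ∨ P = lazyWalkMatrix G) →
        (∀ x, IsEProcess G (μ x) (X x) x) →
        vertexCoverTime μ X ≤ C * ((Fintype.card V : ℝ≥0∞) +
          (Fintype.card V : ℝ≥0∞) * ENNReal.ofReal (Real.log (Fintype.card V)) /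
            (ENNReal.ofReal ℓ * ENNReal.ofReal (1 - lambdaMax P)))) ∧
    -- expanders: eigenvalue gap at least a positive constant `ε`
    (∀ ε : ℝ, 0 < ε → ∃ C : ℝ≥0, ∀ (V : Type u) [Fintype V] [DecidableEq V] (G : SimpleGraph V)
        [DecidableRel G.Adj] (ℓ : ℝ) (P : Matrix V V ℝ) (Ω : Type v) [MeasurableSpace Ω]
        (μ : V → Measure Ω) [∀ x, IsProbabilityMeasure (μ x)] (X : V → ℕ → Ω → V),
        0 < ℓ → IsGoodEvenGraph G Δ ℓ → (P = walkMatrix G ∨ P = lazyWalkMatrix G) →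
        (∀ x, IsEProcess G (μ x) (X x) x) → ε ≤ 1 - lambdaMax P →
        vertexCoverTime μ X ≤ C * ((Fintype.card V : ℝ≥0∞) +
          (Fintype.card V : ℝ≥0∞) * ENNReal.ofReal (Real.log (Fintype.card V)) /
            ENNReal.ofReal ℓ)) ∧
    -- expanders with `ℓ` at least a constant multiple of `log n`: linear cover time
    (∀ ε : ℝ, 0 < ε → ∀ c : ℝ, 0 < c → ∃ C : ℝ≥0, ∀ (V : Type u) [Fintype V] [DecidableEq V]
        (G : SimpleGraph V) [DecidableRel G.Adj] (ℓ : ℝ) (P : Matrix V V ℝ)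
        (Ω : Type v) [MeasurableSpace Ω]
        (μ : V → Measure Ω) [∀ x, IsProbabilityMeasure (μ x)] (X : V → ℕ → Ω → V),
        0 < ℓ → IsGoodEvenGraph G Δ ℓ → (P = walkMatrix G ∨ P = lazyWalkMatrix G) →
        (∀ x, IsEProcess G (μ x) (X x) x) → ε ≤ 1 - lambdaMax P →
        c * Real.log (Fintype.card V) ≤ ℓ →
        (Fintype.card V : ℝ≥0∞) ≤ vertexCoverTime μ X + 1 ∧
          vertexCoverTime μ X ≤ C * (Fintype.card V : ℝ≥0∞)) := by
  -- the bound for expanders, with an explicit constant; the last part uses it as well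
  have hexp : ∀ ε : ℝ, 0 < ε → ∀ (V : Type u) [Fintype V] [DecidableEq V] (G : SimpleGraph V)
      [DecidableRel G.Adj] (ℓ : ℝ) (P : Matrix V V ℝ) (Ω : Type v) [MeasurableSpace Ω]
      (μ : V → Measure Ω) [∀ x, IsProbabilityMeasure (μ x)] (X : V → ℕ → Ω → V),
      0 < ℓ → IsGoodEvenGraph G Δ ℓ → (P = walkMatrix G ∨ P = lazyWalkMatrix G) →
      (∀ x, IsEProcess G (μ x) (X x) x) → ε ≤ 1 - lambdaMax P →
      vertexCoverTime μ X ≤ ((coverConst Δ).toNNReal * (1 + (ε⁻¹).toNNReal) : ℝ≥0) *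
        ((Fintype.card V : ℝ≥0∞) +
        (Fintype.card V : ℝ≥0∞) * ENNReal.ofReal (Real.log (Fintype.card V)) /
          ENNReal.ofReal ℓ) := by
    intro ε hε V _ _ G _ ℓ P Ω _ μ _ X hℓ hG hP hX hgap
    refine (vertexCoverTime_le μ X hℓ hG hP hX).trans ?_
    set N := (Fintype.card V : ℝ≥0∞)
    set Q := N * ENNReal.ofReal (Real.log (Fintype.card V))
    have h1 : Q / (ENNReal.ofReal ℓ * ENNReal.ofReal (1 - lambdaMax P)) ≤
        (ε⁻¹).toNNReal * (Q / ENNReal.ofReal ℓ) := by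
      calc Q / (ENNReal.ofReal ℓ * ENNReal.ofReal (1 - lambdaMax P))
          ≤ Q / (ENNReal.ofReal ℓ * ENNReal.ofReal ε) := by gcongr
        _ = (ENNReal.ofReal ε)⁻¹ * (Q / ENNReal.ofReal ℓ) := by
            rw [div_eq_mul_inv, div_eq_mul_inv,
              ENNReal.mul_inv (Or.inr ENNReal.ofReal_ne_top) (Or.inl ENNReal.ofReal_ne_top)]
            ring
        _ = _ := by rw [← ENNReal.ofReal_inv_of_pos hε]; rfl
    rw [ENNReal.coe_mul, mul_assoc]
    gcongr
    rw [ENNReal.coe_add, ENNReal.coe_one]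
    calc N + Q / (ENNReal.ofReal ℓ * ENNReal.ofReal (1 - lambdaMax P))
        ≤ N + (ε⁻¹).toNNReal * (Q / ENNReal.ofReal ℓ) := by gcongr
      _ ≤ (N + (ε⁻¹).toNNReal * (Q / ENNReal.ofReal ℓ)) +
          ((ε⁻¹).toNNReal * N + Q / ENNReal.ofReal ℓ) := le_self_add
      _ = _ := by ring
  refine ⟨⟨(coverConst Δ).toNNReal, ?_⟩, fun ε hε => ⟨_, hexp ε hε⟩, fun ε hε c hc => ?_⟩
  · intro V _ _ G _ ℓ P Ω _ μ _ X hℓ hG hP hX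
    exact vertexCoverTime_le μ X hℓ hG hP hX
  refine ⟨(coverConst Δ).toNNReal * (1 + (ε⁻¹).toNNReal) * (1 + (c⁻¹).toNNReal), ?_⟩
  intro V _ _ G _ ℓ P Ω _ μ _ X hℓ hG hP hX hgap hcℓ
  have := hG.connected.nonempty
  refine ⟨card_le_vertexCoverTime_add_one μ X, (hexp ε hε V G ℓ P Ω μ X hℓ hG hP hX hgap).trans ?_⟩
  have h1 : (Fintype.card V : ℝ≥0∞) * ENNReal.ofReal (Real.log (Fintype.card V)) /
      ENNReal.ofReal ℓ ≤ (c⁻¹).toNNReal * (Fintype.card V : ℝ≥0∞) := by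
    refine ENNReal.div_le_of_le_mul ?_
    have h2 : ENNReal.ofReal (Real.log (Fintype.card V)) ≤
        (c⁻¹).toNNReal * ENNReal.ofReal ℓ := by
      calc ENNReal.ofReal (Real.log (Fintype.card V)) ≤ ENNReal.ofReal (c⁻¹ * ℓ) := by
            refine ENNReal.ofReal_le_ofReal ?_
            rw [inv_mul_eq_div, le_div_iff₀ hc]
            linarith
        _ = _ := by rw [ENNReal.ofReal_mul (by positivity)]; rfl
    calc (Fintype.card V : ℝ≥0∞) * ENNReal.ofReal (Real.log (Fintype.card V))
        ≤ (Fintype.card V : ℝ≥0∞) * ((c⁻¹).toNNReal * ENNReal.ofReal ℓ) := by gcongr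
      _ = _ := by ring
  rw [ENNReal.coe_mul _ (1 + (c⁻¹).toNNReal), mul_assoc]
  gcongr
  rw [ENNReal.coe_add, ENNReal.coe_one, add_mul, one_mul]
  gcongr
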